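/- **Theorem (Universality).** Let $R$ be a commutative semiring. Let $(H,\oplus,0)$ be a semiadditive category (a category with a zero object and binary biproducts, with injections $\iota_\ell,\iota_r$, projections $\pi_\ell,\pi_r$, diagonal $\Delta$, codiagonal $\nabla$; write $f+g=\nabla\circ(f\oplus g)\circ\Delta$), let $(H,\otimes,1)$ be a symmetric monoidal structure that is distributive, i.e. the canonical maps $X\otimes(Y\oplus Z)\to(X\otimes Y)\oplus(X\otimes Z)$ and $X\otimes 0\to 0$ are isomorphisms, and let $\mathrm{scal}:R\to H(1,1)$ be an isomorphism of semirings. Put $X\mid Y=(X\otimes Y)\oplus(X\oplus Y)$; this is a symmetric monoidal product on $H$ with unit $0$, and $\sigma^{\mid}$ denotes its symmetry. For $x\in H(1,1)$ and $f:X\to Y$, let $x\cdot f:X\to Y$ be $x\otimes f$ conjugated with the unitors $1\otimes X\cong X$, $1\otimes Y\cong Y$. *Diagrams.* Colors are the terms $A::=0\mid 1\mid A\oplus A\mid A\otimes A$, and $\approx$ is the congruence on colors generated by $A\oplus 0\approx A$, $0\oplus A\approx A$, $A\otimes 1\approx A$, $1\otimes A\approx A$ and associativity of $\oplus$ and of $\otimes$.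 For finite lists $X,Y$ of colors, $\mathrm{Cat}(X,Y)$ is the set of diagrams $X\to Y$ in the free PROP (strict symmetric monoidal category whose objects are lists of colors, with concatenation $\parallel$ as product) on the generators: Tensor $[A,B]\to[A\otimes B]$, Plus $[A,B]\to[A\oplus B]$, Contraction $[A,A]\to[A]$, Null $[\,]\to[A]$, the mirror images of these four, Adapter $[A]\to[A']$ for $A\approx A'$, Scalar $s:[A]\to[A]$ for $s\in R$, Unit $[\,]\to[1]$, and its mirror image $[1]\to[\,]$. $\mathrm{FCat}(X,Y)$ is the set of diagrams of the free PROP on the same generators without the Unit and its mirror image. *Semantics.* Interpret each color as an object of $H$ by $[\![0]\!]=0$, $[\![1]\!]=1$, $[\![A\oplus B]\!]=[\![A]\!]\oplus[\![B]\!]$, $[\![A\otimes B]\!]=[\![A]\!]\otimes[\![B]\!]$, and each list by $[\![[\,]]\!]=0$, $[\![[A_1,\dots,A_n]]\!]=(\cdots([\![A_1]\!]\mid[\![A_2]\!])\mid\cdots)\mid[\![A_n]\!]$. For $d\in\mathrm{FCat}(X,Y)$ the morphism $[\![d]\!]\in H([\![X]\!],[\![Y]\!])$ is defined by: identity $\mapsto\mathrm{id}$;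 swap $\mapsto\sigma^{\mid}$; Scalar $s\mapsto \mathrm{scal}(s)\cdot\mathrm{id}$; Plus $\mapsto\pi_r$ and its mirror $\mapsto\iota_r$; Tensor $\mapsto\pi_\ell$ and its mirror $\mapsto\iota_\ell$; Contraction $\mapsto\nabla\circ\pi_r$ and its mirror $\mapsto\iota_r\circ\Delta$; Null and its mirror $\mapsto$ the zero morphisms; Adapter $\mapsto$ the unique isomorphism $[\![A]\!]\cong[\![A']\!]$ composed of associators and unitors of $\oplus$ and $\otimes$ along a derivation of $A\approx A'$; $[\![e\circ d]\!]=[\![e]\!]\circ[\![d]\!]$; and $[\![d\parallel e]\!]=m\circ([\![d]\!]\mid[\![e]\!])\circ m$, where $m$ stands for the canonical isomorphisms between $[\![X\parallel X']\!]$ and $[\![X]\!]\mid[\![X']\!]$ composed of associators and unitors of $\mid$. Let $H^{\oplus 1}$ be the category with the objects of $H$ whose morphisms $X\to Y$ are the morphisms $f:X\oplus 1\to Y\oplus 1$ of $H$ of the form $f=g+\iota_r\circ\pi_r$, composed as in $H$, and let $\mathrm{expand}:(X\oplus 1)\otimes(Y\oplus 1)\cong(X\mid Y)\oplus 1$ be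 the isomorphism given by distributivity. For $d\in\mathrm{Cat}(X,Y)$ the morphism $[\![d]\!]^{\oplus 1}\in H^{\oplus 1}([\![X]\!],[\![Y]\!])$ is defined by: $[\![d]\!]^{\oplus 1}=[\![d]\!]\oplus\mathrm{id}_1$ if $d\in\mathrm{FCat}(X,Y)$; Unit $\mapsto\bigl(0\oplus 1\cong 1\xrightarrow{\Delta}1\oplus 1\bigr)$; mirrored Unit $\mapsto\bigl(1\oplus 1\xrightarrow{\nabla}1\cong 0\oplus 1\bigr)$; $[\![e\circ d]\!]^{\oplus 1}=[\![e]\!]^{\oplus 1}\circ[\![d]\!]^{\oplus 1}$; and $[\![d\parallel e]\!]^{\oplus 1}=(m\oplus\mathrm{id}_1)\circ\mathrm{expand}\circ([\![d]\!]^{\oplus 1}\otimes[\![e]\!]^{\oplus 1})\circ\mathrm{expand}^{-1}\circ(m\oplus\mathrm{id}_1)$. *Claim.* For all lists of colors $X,Y$: 1. for every $f\in H([\![X]\!],[\![Y]\!])$ there is a diagram $d\in\mathrm{FCat}(X,Y)$ with $[\![d]\!]=f$; 2. for every $f\in H^{\oplus 1}([\![X]\!],[\![Y]\!])$ there is a diagram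 $d\in\mathrm{Cat}(X,Y)$ with $[\![d]\!]^{\oplus 1}=f$. -/

import Mathlib

set_option linter.unusedSectionVars false
set_option linter.unusedVariables false
set_option linter.unusedSimpArgs false

open CategoryTheory
open scoped MonoidalCategory

universe w v u

namespace TensorPlus

noncomputable section

open CategoryTheory.Category CategoryTheory.Limits CategoryTheory.MonoidalCategory

/-! ### Semiadditive categories -/

/-- A semiadditive category `(H, ⊕, 0)`: a category with a chosen zero object and chosen
binary biproducts. -/
class Semiadditive (H : Type v) [Category.{w} H] extends HasZeroMorphisms H where
  /-- the zero object -/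
  zeroObj : H
  isZero_zeroObj : IsZero zeroObj
  /-- the biproducts -/
  biprodData : ∀ X Y : H, BinaryBiproductData X Y

section Semiadditive

variable {H : Type v} [Category.{w} H] [Semiadditive H]

/-- The zero object. -/
abbrev zobj (H : Type v) [Category.{w} H] [Semiadditive H] : H := Semiadditive.zeroObj

/-- The biproduct of two objects. -/
def osum (X Y : H) : H := (Semiadditive.biprodData X Y).bicone.pt

infixr:65 " ⊞ₛ " => osum

/-- The left injection. -/
def inl {X Y : H} : X ⟶ X ⊞ₛ Y := (Semiadditive.biprodData X Y).bicone.inl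
/-- The right injection. -/
def inr {X Y : H} : Y ⟶ X ⊞ₛ Y := (Semiadditive.biprodData X Y).bicone.inr
/-- The left projection. -/
def fst {X Y : H} : X ⊞ₛ Y ⟶ X := (Semiadditive.biprodData X Y).bicone.fst
/-- The right projection. -/
def snd {X Y : H} : X ⊞ₛ Y ⟶ Y := (Semiadditive.biprodData X Y).bicone.snd

/-- Pairing, from the universal property of the product. -/
def lift {W X Y : H} (f : W ⟶ X) (g : W ⟶ Y) : W ⟶ X ⊞ₛ Y :=
  (Semiadditive.biprodData X Y).isBilimit.isLimit.lift (BinaryFan.mk f g)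

/-- Copairing, from the universal property of the coproduct. -/
def desc {W X Y : H} (f : X ⟶ W) (g : Y ⟶ W) : X ⊞ₛ Y ⟶ W :=
  (Semiadditive.biprodData X Y).isBilimit.isColimit.desc (BinaryCofan.mk f g)

/-- The diagonal. -/
def diag (X : H) : X ⟶ X ⊞ₛ X := lift (𝟙 X) (𝟙 X)

/-- The codiagonal. -/
def codiag (X : H) : X ⊞ₛ X ⟶ X := desc (𝟙 X) (𝟙 X)

/-- The action of the biproduct on morphisms. -/
def sumMap {X Y X' Y' : H} (f : X ⟶ X') (g : Y ⟶ Y') : X ⊞ₛ Y ⟶ X' ⊞ₛ Y' :=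
  lift (fst ≫ f) (snd ≫ g)

@[simp] theorem inl_fst {X Y : H} : (inl : X ⟶ X ⊞ₛ Y) ≫ fst = 𝟙 X :=
  (Semiadditive.biprodData X Y).bicone.inl_fst
@[simp] theorem inl_snd {X Y : H} : (inl : X ⟶ X ⊞ₛ Y) ≫ snd = 0 :=
  (Semiadditive.biprodData X Y).bicone.inl_snd
@[simp] theorem inr_fst {X Y : H} : (inr : Y ⟶ X ⊞ₛ Y) ≫ fst = 0 :=
  (Semiadditive.biprodData X Y).bicone.inr_fst
@[simp] theorem inr_snd {X Y : H} : (inr : Y ⟶ X ⊞ₛ Y) ≫ snd = 𝟙 Y :=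
  (Semiadditive.biprodData X Y).bicone.inr_snd
@[simp] theorem lift_fst {W X Y : H} (f : W ⟶ X) (g : W ⟶ Y) : lift f g ≫ fst = f :=
  (Semiadditive.biprodData X Y).isBilimit.isLimit.fac (BinaryFan.mk f g) ⟨WalkingPair.left⟩
@[simp] theorem lift_snd {W X Y : H} (f : W ⟶ X) (g : W ⟶ Y) : lift f g ≫ snd = g :=
  (Semiadditive.biprodData X Y).isBilimit.isLimit.fac (BinaryFan.mk f g) ⟨WalkingPair.right⟩
@[simp] theorem inl_desc {W X Y : H} (f : X ⟶ W) (g : Y ⟶ W) : inl ≫ desc f g = f :=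
  (Semiadditive.biprodData X Y).isBilimit.isColimit.fac (BinaryCofan.mk f g) ⟨WalkingPair.left⟩
@[simp] theorem inr_desc {W X Y : H} (f : X ⟶ W) (g : Y ⟶ W) : inr ≫ desc f g = g :=
  (Semiadditive.biprodData X Y).isBilimit.isColimit.fac (BinaryCofan.mk f g) ⟨WalkingPair.right⟩

@[simp] theorem inl_fst_assoc {X Y Z : H} (h : X ⟶ Z) :
    (inl : X ⟶ X ⊞ₛ Y) ≫ fst ≫ h = h := by rw [← assoc, inl_fst, id_comp]
@[simp] theorem inl_snd_assoc {X Y Z : H} (h : Y ⟶ Z) :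
    (inl : X ⟶ X ⊞ₛ Y) ≫ snd ≫ h = 0 := by rw [← assoc, inl_snd, zero_comp]
@[simp] theorem inr_fst_assoc {X Y Z : H} (h : X ⟶ Z) :
    (inr : Y ⟶ X ⊞ₛ Y) ≫ fst ≫ h = 0 := by rw [← assoc, inr_fst, zero_comp]
@[simp] theorem inr_snd_assoc {X Y Z : H} (h : Y ⟶ Z) :
    (inr : Y ⟶ X ⊞ₛ Y) ≫ snd ≫ h = h := by rw [← assoc, inr_snd, id_comp]
@[simp] theorem lift_fst_assoc {W X Y Z : H} (f : W ⟶ X) (g : W ⟶ Y) (h : X ⟶ Z) :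
    lift f g ≫ fst ≫ h = f ≫ h := by rw [← assoc, lift_fst]
@[simp] theorem lift_snd_assoc {W X Y Z : H} (f : W ⟶ X) (g : W ⟶ Y) (h : Y ⟶ Z) :
    lift f g ≫ snd ≫ h = g ≫ h := by rw [← assoc, lift_snd]
@[simp] theorem inl_desc_assoc {W X Y Z : H} (f : X ⟶ W) (g : Y ⟶ W) (h : W ⟶ Z) :
    inl ≫ desc f g ≫ h = f ≫ h := by rw [← assoc, inl_desc]
@[simp] theorem inr_desc_assoc {W X Y Z : H} (f : X ⟶ W) (g : Y ⟶ W) (h : W ⟶ Z) :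
    inr ≫ desc f g ≫ h = g ≫ h := by rw [← assoc, inr_desc]

theorem lift_ext {W X Y : H} {f g : W ⟶ X ⊞ₛ Y} (h₁ : f ≫ fst = g ≫ fst)
    (h₂ : f ≫ snd = g ≫ snd) : f = g :=
  BinaryFan.IsLimit.hom_ext (Semiadditive.biprodData X Y).isBilimit.isLimit h₁ h₂

theorem desc_ext {W X Y : H} {f g : X ⊞ₛ Y ⟶ W} (h₁ : inl ≫ f = inl ≫ g)
    (h₂ : inr ≫ f = inr ≫ g) : f = g :=
  BinaryCofan.IsColimit.hom_ext (Semiadditive.biprodData X Y).isBilimit.isColimit h₁ h₂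

theorem comp_lift {V W X Y : H} (h : V ⟶ W) (f : W ⟶ X) (g : W ⟶ Y) :
    h ≫ lift f g = lift (h ≫ f) (h ≫ g) :=
  lift_ext (by simp) (by simp)

theorem desc_comp {V W X Y : H} (f : X ⟶ W) (g : Y ⟶ W) (h : W ⟶ V) :
    desc f g ≫ h = desc (f ≫ h) (g ≫ h) :=
  desc_ext (by simp) (by simp)

@[simp] theorem inl_sumMap {X Y X' Y' : H} (f : X ⟶ X') (g : Y ⟶ Y') :
    inl ≫ sumMap f g = f ≫ inl :=
  lift_ext (by simp [sumMap]) (by simp [sumMap])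
@[simp] theorem inr_sumMap {X Y X' Y' : H} (f : X ⟶ X') (g : Y ⟶ Y') :
    inr ≫ sumMap f g = g ≫ inr :=
  lift_ext (by simp [sumMap]) (by simp [sumMap])
@[simp] theorem inl_sumMap_assoc {X Y X' Y' Z : H} (f : X ⟶ X') (g : Y ⟶ Y')
    (h : X' ⊞ₛ Y' ⟶ Z) : inl ≫ sumMap f g ≫ h = f ≫ inl ≫ h := by
  rw [← assoc, inl_sumMap, assoc]
@[simp] theorem inr_sumMap_assoc {X Y X' Y' Z : H} (f : X ⟶ X') (g : Y ⟶ Y')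
    (h : X' ⊞ₛ Y' ⟶ Z) : inr ≫ sumMap f g ≫ h = g ≫ inr ≫ h := by
  rw [← assoc, inr_sumMap, assoc]
@[simp] theorem sumMap_fst {X Y X' Y' : H} (f : X ⟶ X') (g : Y ⟶ Y') :
    sumMap f g ≫ fst = fst ≫ f := lift_fst _ _
@[simp] theorem sumMap_snd {X Y X' Y' : H} (f : X ⟶ X') (g : Y ⟶ Y') :
    sumMap f g ≫ snd = snd ≫ g := lift_snd _ _

@[simp] theorem sumMap_id (X Y : H) : sumMap (𝟙 X) (𝟙 Y) = 𝟙 (X ⊞ₛ Y) :=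
  desc_ext (by simp) (by simp)

@[simp] theorem sumMap_comp {X Y X' Y' X'' Y'' : H} (f : X ⟶ X') (g : Y ⟶ Y') (f' : X' ⟶ X'')
    (g' : Y' ⟶ Y'') : sumMap f g ≫ sumMap f' g' = sumMap (f ≫ f') (g ≫ g') :=
  desc_ext (by simp) (by simp)

/-- The biproduct of two isomorphisms. -/
@[simps] def sumIso {X Y X' Y' : H} (f : X ≅ X') (g : Y ≅ Y') : X ⊞ₛ Y ≅ X' ⊞ₛ Y' where
  hom := sumMap f.hom g.hom
  inv := sumMap f.inv g.inv
  hom_inv_id := by simp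
  inv_hom_id := by simp

theorem zobj_hom_ext {X : H} (f g : zobj H ⟶ X) : f = g :=
  Semiadditive.isZero_zeroObj.eq_of_src f g

theorem hom_zobj_ext {X : H} (f g : X ⟶ zobj H) : f = g :=
  Semiadditive.isZero_zeroObj.eq_of_tgt f g

/-- The associator of the biproduct. -/
def sumAssoc (X Y Z : H) : (X ⊞ₛ Y) ⊞ₛ Z ≅ X ⊞ₛ (Y ⊞ₛ Z) where
  hom := lift (fst ≫ fst) (lift (fst ≫ snd) snd)
  inv := lift (lift fst (snd ≫ fst)) (snd ≫ snd)
  hom_inv_id := lift_ext (lift_ext (by simp) (by simp)) (by simp)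
  inv_hom_id := lift_ext (by simp) (lift_ext (by simp) (by simp))

/-- The left unitor of the biproduct. -/
@[simps] def zeroSum (X : H) : zobj H ⊞ₛ X ≅ X where
  hom := snd
  inv := inr
  hom_inv_id := desc_ext (zobj_hom_ext _ _) (by simp)
  inv_hom_id := by simp

/-- The right unitor of the biproduct. -/
@[simps] def sumZero (X : H) : X ⊞ₛ zobj H ≅ X where
  hom := fst
  inv := inl
  hom_inv_id := desc_ext (by simp) (zobj_hom_ext _ _)
  inv_hom_id := by simp

/-- The symmetry of the biproduct. -/
def sumSwap (X Y : H) : X ⊞ₛ Y ≅ Y ⊞ₛ X where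
  hom := lift snd fst
  inv := lift snd fst
  hom_inv_id := lift_ext (by simp) (by simp)
  inv_hom_id := lift_ext (by simp) (by simp)

@[simp] theorem inl_sumSwap (X Y : H) : inl ≫ (sumSwap X Y).hom = inr :=
  lift_ext (by simp [sumSwap]) (by simp [sumSwap])
@[simp] theorem inr_sumSwap (X Y : H) : inr ≫ (sumSwap X Y).hom = inl :=
  lift_ext (by simp [sumSwap]) (by simp [sumSwap])
@[simp] theorem inl_sumSwap_assoc {X Y Z : H} (h : Y ⊞ₛ X ⟶ Z) :
    inl ≫ (sumSwap X Y).hom ≫ h = inr ≫ h := by rw [← assoc, inl_sumSwap]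
@[simp] theorem inr_sumSwap_assoc {X Y Z : H} (h : Y ⊞ₛ X ⟶ Z) :
    inr ≫ (sumSwap X Y).hom ≫ h = inl ≫ h := by rw [← assoc, inr_sumSwap]

/-! The addition of morphisms. -/

/-- The sum `∇ ∘ (f ⊕ g) ∘ Δ` of two parallel morphisms. -/
def homAdd {X Y : H} (f g : X ⟶ Y) : X ⟶ Y := diag X ≫ sumMap f g ≫ codiag Y

theorem homAdd_eq_lift {X Y : H} (f g : X ⟶ Y) : homAdd f g = lift f g ≫ codiag Y := by
  rw [homAdd, ← assoc]
  congr 1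
  exact lift_ext (by simp [diag]) (by simp [diag])

theorem homAdd_eq_desc {X Y : H} (f g : X ⟶ Y) : homAdd f g = diag X ≫ desc f g := by
  rw [homAdd]
  congr 1
  exact desc_ext (by simp [codiag]) (by simp [codiag])

theorem comp_homAdd {W X Y : H} (h : W ⟶ X) (f g : X ⟶ Y) :
    h ≫ homAdd f g = homAdd (h ≫ f) (h ≫ g) := by
  rw [homAdd_eq_lift, homAdd_eq_lift, ← assoc, comp_lift]

theorem homAdd_comp {X Y Z : H} (f g : X ⟶ Y) (h : Y ⟶ Z) :
    homAdd f g ≫ h = homAdd (f ≫ h) (g ≫ h) := by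
  rw [homAdd_eq_desc, homAdd_eq_desc, assoc, desc_comp]

theorem homAdd_zero {X Y : H} (f : X ⟶ Y) : homAdd f 0 = f := by
  have : desc f (0 : X ⟶ Y) = fst ≫ f := desc_ext (by simp) (by simp)
  rw [homAdd_eq_desc, this]; simp [diag]

theorem zero_homAdd {X Y : H} (f : X ⟶ Y) : homAdd 0 f = f := by
  have : desc (0 : X ⟶ Y) f = snd ≫ f := desc_ext (by simp) (by simp)
  rw [homAdd_eq_desc, this]; simp [diag]

theorem homAdd_interchange {X Y : H} (a b c d : X ⟶ Y) :
    homAdd (homAdd a b) (homAdd c d) = homAdd (homAdd a c) (homAdd b d) := by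
  have h : lift (homAdd a b) (homAdd c d) = homAdd (lift a c) (lift b d) :=
    lift_ext (by simp [homAdd_comp]) (by simp [homAdd_comp])
  rw [homAdd_eq_lift, h, homAdd_comp, ← homAdd_eq_lift, ← homAdd_eq_lift]

/-- The homsets of a semiadditive category are commutative monoids. -/
instance homAddCommMonoid (X Y : H) : AddCommMonoid (X ⟶ Y) where
  add := homAdd
  zero := 0
  nsmul := letI : Add (X ⟶ Y) := ⟨homAdd⟩; nsmulRec
  add_assoc a b c := by
    have := homAdd_interchange a b 0 c
    rwa [zero_homAdd, homAdd_zero] at this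
  zero_add := zero_homAdd
  add_zero := homAdd_zero
  add_comm a b := by
    have := homAdd_interchange 0 a b 0
    rwa [zero_homAdd, homAdd_zero, zero_homAdd, homAdd_zero] at this

theorem add_def {X Y : H} (f g : X ⟶ Y) : f + g = diag X ≫ sumMap f g ≫ codiag Y := rfl

theorem comp_add {W X Y : H} (h : W ⟶ X) (f g : X ⟶ Y) : h ≫ (f + g) = h ≫ f + h ≫ g :=
  comp_homAdd h f g

theorem add_comp {X Y Z : H} (f g : X ⟶ Y) (h : Y ⟶ Z) : (f + g) ≫ h = f ≫ h + g ≫ h :=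
  homAdd_comp f g h

/-- The endomorphisms of an object form a semiring under addition and composition. -/
instance endSemiring (X : H) : Semiring (End X) :=
  { End.monoid, (homAddCommMonoid X X : AddCommMonoid (End X)) with
    left_distrib := fun a b c => add_comp b c a
    right_distrib := fun a b c => comp_add c a b
    zero_mul := fun a => comp_zero (f := a)
    mul_zero := fun a => zero_comp (f := a) }

end Semiadditive

/-! ### Distributive symmetric monoidal structures -/

/-- A monoidal structure on a semiadditive category is distributive when the left distributors
`X ⊗ (Y ⊕ Z) ⟶ (X ⊗ Y) ⊕ (X ⊗ Z)` and the left annihilators `X ⊗ 0 ⟶ 0` are isomorphisms. -/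
class Distributive (H : Type v) [Category.{w} H] [MonoidalCategory H] [Semiadditive H] :
    Prop where
  isIso_distL : ∀ X Y Z : H, IsIso (lift (X ◁ fst) (X ◁ snd) : X ⊗ (Y ⊞ₛ Z) ⟶ (X ⊗ Y) ⊞ₛ (X ⊗ Z))
  isIso_annL : ∀ X : H, IsIso (0 : X ⊗ zobj H ⟶ zobj H)

section Distributive

variable {H : Type v} [Category.{w} H] [MonoidalCategory H] [SymmetricCategory H]
  [Semiadditive H] [Distributive H]

theorem isZero_tensor_zobj (X : H) : IsZero (X ⊗ zobj H) :=
  have := Distributive.isIso_annL X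
  Semiadditive.isZero_zeroObj.of_iso (asIso (0 : X ⊗ zobj H ⟶ zobj H))

theorem whiskerLeft_zero' (X : H) {Y Z : H} : X ◁ (0 : Y ⟶ Z) = 0 := by
  have h : (0 : Y ⟶ Z) = (0 : Y ⟶ zobj H) ≫ (0 : zobj H ⟶ Z) := by simp
  rw [h, whiskerLeft_comp, (isZero_tensor_zobj X).eq_zero_of_tgt (X ◁ (0 : Y ⟶ zobj H)), zero_comp]

theorem zero_whiskerRight' {Y Z : H} (X : H) : (0 : Y ⟶ Z) ▷ X = 0 := by
  have h := BraidedCategory.braiding_naturality_left (0 : Y ⟶ Z) X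
  rw [whiskerLeft_zero', comp_zero] at h
  rw [← cancel_mono (β_ Z X).hom, h, zero_comp]

/-- The left distributor. -/
def distL (X Y Z : H) : X ⊗ (Y ⊞ₛ Z) ≅ (X ⊗ Y) ⊞ₛ (X ⊗ Z) where
  hom := lift (X ◁ fst) (X ◁ snd)
  inv := desc (X ◁ inl) (X ◁ inr)
  hom_inv_id := by
    have := Distributive.isIso_distL X Y Z
    rw [← cancel_mono (lift (X ◁ fst) (X ◁ snd) : X ⊗ (Y ⊞ₛ Z) ⟶ (X ⊗ Y) ⊞ₛ (X ⊗ Z)), assoc,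
      id_comp]
    have h : desc (X ◁ inl) (X ◁ inr) ≫
        (lift (X ◁ fst) (X ◁ snd) : X ⊗ (Y ⊞ₛ Z) ⟶ (X ⊗ Y) ⊞ₛ (X ⊗ Z)) = 𝟙 _ := by
      refine desc_ext (lift_ext ?_ ?_) (lift_ext ?_ ?_) <;>
        simp [← whiskerLeft_comp, whiskerLeft_zero']
    rw [h, comp_id]
  inv_hom_id := by
    refine desc_ext (lift_ext ?_ ?_) (lift_ext ?_ ?_) <;>
      simp [← whiskerLeft_comp, whiskerLeft_zero']

theorem whiskerLeft_desc_ext {X Y Z W : H} {f g : X ⊗ (Y ⊞ₛ Z) ⟶ W}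
    (h₁ : X ◁ inl ≫ f = X ◁ inl ≫ g) (h₂ : X ◁ inr ≫ f = X ◁ inr ≫ g) : f = g := by
  rw [← cancel_epi (distL X Y Z).inv]
  exact desc_ext (by simpa [distL] using h₁) (by simpa [distL] using h₂)

theorem whiskerRight_desc_ext {X Y Z W : H} {f g : (Y ⊞ₛ Z) ⊗ X ⟶ W}
    (h₁ : inl ▷ X ≫ f = inl ▷ X ≫ g) (h₂ : inr ▷ X ≫ f = inr ▷ X ≫ g) : f = g := by
  rw [← cancel_epi (β_ X (Y ⊞ₛ Z)).hom]
  apply whiskerLeft_desc_ext <;> simp [h₁, h₂]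

/-- The right distributor. -/
def distR (X Y Z : H) : (X ⊞ₛ Y) ⊗ Z ≅ (X ⊗ Z) ⊞ₛ (Y ⊗ Z) where
  hom := lift (fst ▷ Z) (snd ▷ Z)
  inv := desc (inl ▷ Z) (inr ▷ Z)
  hom_inv_id := by
    refine whiskerRight_desc_ext ?_ ?_ <;> rw [← assoc, comp_lift] <;>
      simp [← comp_whiskerRight, zero_whiskerRight']
    · have : lift (𝟙 (X ⊗ Z)) (0 : X ⊗ Z ⟶ Y ⊗ Z) = inl := lift_ext (by simp) (by simp)
      simp [this]
    · have : lift (0 : Y ⊗ Z ⟶ X ⊗ Z) (𝟙 (Y ⊗ Z)) = inr := lift_ext (by simp) (by simp)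
      simp [this]
  inv_hom_id := by
    refine desc_ext (lift_ext ?_ ?_) (lift_ext ?_ ?_) <;>
      simp [← comp_whiskerRight, zero_whiskerRight']

@[simp] theorem inl_distL_inv (X Y Z : H) : inl ≫ (distL X Y Z).inv = X ◁ inl := inl_desc _ _
@[simp] theorem inr_distL_inv (X Y Z : H) : inr ≫ (distL X Y Z).inv = X ◁ inr := inr_desc _ _
@[simp] theorem inl_distR_inv (X Y Z : H) : inl ≫ (distR X Y Z).inv = inl ▷ Z := inl_desc _ _
@[simp] theorem inr_distR_inv (X Y Z : H) : inr ≫ (distR X Y Z).inv = inr ▷ Z := inr_desc _ _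

@[simp] theorem inl_distL_inv_assoc (X Y Z : H) {W : H} (h : X ⊗ (Y ⊞ₛ Z) ⟶ W) :
    inl ≫ (distL X Y Z).inv ≫ h = X ◁ inl ≫ h := inl_desc_assoc _ _ _
@[simp] theorem inr_distL_inv_assoc (X Y Z : H) {W : H} (h : X ⊗ (Y ⊞ₛ Z) ⟶ W) :
    inr ≫ (distL X Y Z).inv ≫ h = X ◁ inr ≫ h := inr_desc_assoc _ _ _

@[simp] theorem inl_distL (X Y Z : H) {W : H} (h : (X ⊗ Y) ⊞ₛ (X ⊗ Z) ⟶ W) :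
    X ◁ inl ≫ (distL X Y Z).hom ≫ h = inl ≫ h := by
  rw [← inl_distL_inv, assoc, Iso.inv_hom_id_assoc]
@[simp] theorem inr_distL (X Y Z : H) {W : H} (h : (X ⊗ Y) ⊞ₛ (X ⊗ Z) ⟶ W) :
    X ◁ inr ≫ (distL X Y Z).hom ≫ h = inr ≫ h := by
  rw [← inr_distL_inv, assoc, Iso.inv_hom_id_assoc]
@[simp] theorem inl_distR (X Y Z : H) {W : H} (h : (X ⊗ Z) ⊞ₛ (Y ⊗ Z) ⟶ W) :
    inl ▷ Z ≫ (distR X Y Z).hom ≫ h = inl ≫ h := by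
  rw [← inl_distR_inv, assoc, Iso.inv_hom_id_assoc]
@[simp] theorem inr_distR (X Y Z : H) {W : H} (h : (X ⊗ Z) ⊞ₛ (Y ⊗ Z) ⟶ W) :
    inr ▷ Z ≫ (distR X Y Z).hom ≫ h = inr ≫ h := by
  rw [← inr_distR_inv, assoc, Iso.inv_hom_id_assoc]

/-- The left annihilator. -/
def annL (X : H) : X ⊗ zobj H ≅ zobj H :=
  (isZero_tensor_zobj X).iso Semiadditive.isZero_zeroObj

theorem isZero_zobj_tensor (X : H) : IsZero (zobj H ⊗ X) :=
  (isZero_tensor_zobj X).of_iso (β_ (zobj H) X)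

/-- The right annihilator. -/
def annR (X : H) : zobj H ⊗ X ≅ zobj H :=
  (isZero_zobj_tensor X).iso Semiadditive.isZero_zeroObj

/-- The action `x • f = λ ∘ (x ⊗ f) ∘ λ⁻¹` of `H(1,1)` on morphisms. -/
def scalAct (x : End (𝟙_ H)) {X Y : H} (f : X ⟶ Y) : X ⟶ Y :=
  (λ_ X).inv ≫ ((x : 𝟙_ H ⟶ 𝟙_ H) ⊗ₘ f) ≫ (λ_ Y).hom

/-! ### The third monoidal product `X | Y = (X ⊗ Y) ⊕ (X ⊕ Y)` -/

/-- The object `X | Y = (X ⊗ Y) ⊕ (X ⊕ Y)`. -/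
abbrev parObj (X Y : H) : H := (X ⊗ Y) ⊞ₛ (X ⊞ₛ Y)

/-- The morphism `f | g = (f ⊗ g) ⊕ (f ⊕ g)`. -/
def parMap {X Y X' Y' : H} (f : X ⟶ X') (g : Y ⟶ Y') : parObj X Y ⟶ parObj X' Y' :=
  sumMap (f ⊗ₘ g) (sumMap f g)

/-- The left unitor of `|`. -/
def parLeftUnitor (X : H) : parObj (zobj H) X ≅ X :=
  sumIso (annR X) (zeroSum X) ≪≫ zeroSum X

/-- The right unitor of `|`. -/
def parRightUnitor (X : H) : parObj X (zobj H) ≅ X :=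
  sumIso (annL X) (sumZero X) ≪≫ zeroSum X

/-- The symmetry of `|`. -/
def parSwap (X Y : H) : parObj X Y ≅ parObj Y X :=
  sumIso (β_ X Y) (sumSwap X Y)

/-- The rearrangement of seven summands used in the associator of `|`, a composite of
associators and symmetries of `⊕`. -/
@[simps] def sumShuffle (P AC BC AB A B C : H) :
    (P ⊞ₛ (AC ⊞ₛ BC)) ⊞ₛ ((AB ⊞ₛ (A ⊞ₛ B)) ⊞ₛ C) ≅
      (P ⊞ₛ (AB ⊞ₛ AC)) ⊞ₛ (A ⊞ₛ (BC ⊞ₛ (B ⊞ₛ C))) where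
  hom := desc
    (desc (inl ≫ inl) (desc (inr ≫ inr ≫ inl) (inl ≫ inr ≫ inr)))
    (desc (desc (inl ≫ inr ≫ inl) (desc (inl ≫ inr) (inl ≫ inr ≫ inr ≫ inr)))
      (inr ≫ inr ≫ inr ≫ inr))
  inv := desc
    (desc (inl ≫ inl) (desc (inl ≫ inl ≫ inr) (inl ≫ inr ≫ inl)))
    (desc (inl ≫ inr ≫ inl ≫ inr) (desc (inr ≫ inr ≫ inl)
      (desc (inr ≫ inr ≫ inl ≫ inr) (inr ≫ inr))))
  hom_inv_id := by
    refine desc_ext (desc_ext ?_ (desc_ext ?_ ?_)) (desc_ext (desc_ext ?_ (desc_ext ?_ ?_)) ?_) <;>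
      simp
  inv_hom_id := by
    refine desc_ext (desc_ext ?_ (desc_ext ?_ ?_)) (desc_ext ?_ (desc_ext ?_ (desc_ext ?_ ?_))) <;>
      simp

/-- The associator of `|`. -/
def parAssoc (A B C : H) : parObj (parObj A B) C ≅ parObj A (parObj B C) :=
  sumIso (distR (A ⊗ B) (A ⊞ₛ B) C) (Iso.refl _) ≪≫
  sumIso (sumIso (α_ A B C) (distR A B C)) (Iso.refl _) ≪≫
  sumShuffle _ _ _ _ _ _ _ ≪≫
  sumIso (sumIso (Iso.refl _) (distL A B C).symm) (Iso.refl _) ≪≫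
  sumIso (distL A (B ⊗ C) (B ⊞ₛ C)).symm (Iso.refl _)

/-- The rearrangement `(P ⊕ Q) ⊕ (S ⊕ T) ≅ (P ⊕ (Q ⊕ S)) ⊕ T`. -/
def sumRebracket (P Q S T : H) : (P ⊞ₛ Q) ⊞ₛ (S ⊞ₛ T) ≅ (P ⊞ₛ (Q ⊞ₛ S)) ⊞ₛ T :=
  (sumAssoc _ _ _).symm ≪≫ sumIso (sumAssoc _ _ _) (Iso.refl _)

/-- The natural isomorphism `(X ⊕ 1) ⊗ (Y ⊕ 1) ≅ (X | Y) ⊕ 1`. -/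
def expand (X Y : H) : (X ⊞ₛ 𝟙_ H) ⊗ (Y ⊞ₛ 𝟙_ H) ≅ parObj X Y ⊞ₛ 𝟙_ H :=
  distR X (𝟙_ H) (Y ⊞ₛ 𝟙_ H) ≪≫
  sumIso (distL X Y (𝟙_ H)) (λ_ (Y ⊞ₛ 𝟙_ H)) ≪≫
  sumIso (sumIso (Iso.refl _) (ρ_ X)) (Iso.refl _) ≪≫
  sumRebracket _ _ _ _

theorem inl_inl_rebr (P Q S T : H) : inl ≫ inl ≫ (sumRebracket P Q S T).hom = inl ≫ inl := by
  refine lift_ext (lift_ext ?_ (lift_ext ?_ ?_)) ?_ <;> simp [sumRebracket, sumAssoc, comp_lift]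
theorem inl_inr_rebr (P Q S T : H) :
    inr ≫ inl ≫ (sumRebracket P Q S T).hom = inl ≫ inr ≫ inl := by
  refine lift_ext (lift_ext ?_ (lift_ext ?_ ?_)) ?_ <;> simp [sumRebracket, sumAssoc, comp_lift]
theorem inr_inl_rebr (P Q S T : H) :
    inl ≫ inr ≫ (sumRebracket P Q S T).hom = inr ≫ inr ≫ inl := by
  refine lift_ext (lift_ext ?_ (lift_ext ?_ ?_)) ?_ <;> simp [sumRebracket, sumAssoc, comp_lift]
theorem inr_inr_rebr (P Q S T : H) :
    inr ≫ inr ≫ (sumRebracket P Q S T).hom = inr := by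
  refine lift_ext (lift_ext ?_ (lift_ext ?_ ?_)) ?_ <;> simp [sumRebracket, sumAssoc, comp_lift]

theorem expand_ll (X Y : H) :
    inl ▷ Y ≫ (X ⊞ₛ 𝟙_ H) ◁ inl ≫ (expand X Y).hom = inl ≫ inl := by
  rw [← whisker_exchange_assoc]
  simp [expand, inl_inl_rebr]
theorem expand_lr (X Y : H) :
    inl ▷ 𝟙_ H ≫ (X ⊞ₛ 𝟙_ H) ◁ inr ≫ (expand X Y).hom = (ρ_ X).hom ≫ inl ≫ inr ≫ inl := by
  rw [← whisker_exchange_assoc]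
  simp [expand, inl_inr_rebr]
theorem expand_rl (X Y : H) :
    inr ▷ Y ≫ (X ⊞ₛ 𝟙_ H) ◁ inl ≫ (expand X Y).hom = (λ_ Y).hom ≫ inr ≫ inr ≫ inl := by
  rw [← whisker_exchange_assoc]
  simp [expand, inr_inl_rebr]
theorem expand_rr (X Y : H) :
    inr ▷ 𝟙_ H ≫ (X ⊞ₛ 𝟙_ H) ◁ inr ≫ (expand X Y).hom = (λ_ (𝟙_ H)).hom ≫ inr := by
  rw [← whisker_exchange_assoc]
  simp [expand, inr_inr_rebr]

theorem sumtensor_ext {A A' B B' W : H} {f g : (A ⊞ₛ A') ⊗ (B ⊞ₛ B') ⟶ W}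
    (h₁ : inl ▷ B ≫ (A ⊞ₛ A') ◁ inl ≫ f = inl ▷ B ≫ (A ⊞ₛ A') ◁ inl ≫ g)
    (h₂ : inl ▷ B' ≫ (A ⊞ₛ A') ◁ inr ≫ f = inl ▷ B' ≫ (A ⊞ₛ A') ◁ inr ≫ g)
    (h₃ : inr ▷ B ≫ (A ⊞ₛ A') ◁ inl ≫ f = inr ▷ B ≫ (A ⊞ₛ A') ◁ inl ≫ g)
    (h₄ : inr ▷ B' ≫ (A ⊞ₛ A') ◁ inr ≫ f = inr ▷ B' ≫ (A ⊞ₛ A') ◁ inr ≫ g) : f = g :=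
  whiskerLeft_desc_ext (whiskerRight_desc_ext h₁ h₃) (whiskerRight_desc_ext h₂ h₄)

@[simp] theorem expand_ll_assoc (X Y : H) {W : H} (h : parObj X Y ⊞ₛ 𝟙_ H ⟶ W) :
    inl ▷ Y ≫ (X ⊞ₛ 𝟙_ H) ◁ inl ≫ (expand X Y).hom ≫ h = inl ≫ inl ≫ h := by
  simpa using expand_ll X Y =≫ h
@[simp] theorem expand_lr_assoc (X Y : H) {W : H} (h : parObj X Y ⊞ₛ 𝟙_ H ⟶ W) :
    inl ▷ 𝟙_ H ≫ (X ⊞ₛ 𝟙_ H) ◁ inr ≫ (expand X Y).hom ≫ h =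
      (ρ_ X).hom ≫ inl ≫ inr ≫ inl ≫ h := by
  simpa using expand_lr X Y =≫ h
@[simp] theorem expand_rl_assoc (X Y : H) {W : H} (h : parObj X Y ⊞ₛ 𝟙_ H ⟶ W) :
    inr ▷ Y ≫ (X ⊞ₛ 𝟙_ H) ◁ inl ≫ (expand X Y).hom ≫ h =
      (λ_ Y).hom ≫ inr ≫ inr ≫ inl ≫ h := by
  simpa using expand_rl X Y =≫ h
@[simp] theorem expand_rr_assoc (X Y : H) {W : H} (h : parObj X Y ⊞ₛ 𝟙_ H ⟶ W) :
    inr ▷ 𝟙_ H ≫ (X ⊞ₛ 𝟙_ H) ◁ inr ≫ (expand X Y).hom ≫ h = (λ_ (𝟙_ H)).hom ≫ inr ≫ h := by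
  simpa using expand_rr X Y =≫ h

theorem tensor_ext {A A' B B' W : H} {f g : (A ⊞ₛ A') ⊗ (B ⊞ₛ B') ⟶ W}
    (h₁ : ((inl : A ⟶ A ⊞ₛ A') ⊗ₘ (inl : B ⟶ B ⊞ₛ B')) ≫ f = (inl ⊗ₘ inl) ≫ g)
    (h₂ : ((inl : A ⟶ A ⊞ₛ A') ⊗ₘ (inr : B' ⟶ B ⊞ₛ B')) ≫ f = (inl ⊗ₘ inr) ≫ g)
    (h₃ : ((inr : A' ⟶ A ⊞ₛ A') ⊗ₘ (inl : B ⟶ B ⊞ₛ B')) ≫ f = (inr ⊗ₘ inl) ≫ g)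
    (h₄ : ((inr : A' ⟶ A ⊞ₛ A') ⊗ₘ (inr : B' ⟶ B ⊞ₛ B')) ≫ f = (inr ⊗ₘ inr) ≫ g) : f = g := by
  simp only [MonoidalCategory.tensorHom_def, assoc] at h₁ h₂ h₃ h₄
  exact sumtensor_ext h₁ h₂ h₃ h₄

theorem tensor_ext3 {A A' B B' C C' W : H}
    {f g : ((A ⊞ₛ A') ⊗ (B ⊞ₛ B')) ⊗ (C ⊞ₛ C') ⟶ W}
    (h₁ : (((inl : A ⟶ A ⊞ₛ A') ⊗ₘ (inl : B ⟶ B ⊞ₛ B')) ⊗ₘ (inl : C ⟶ C ⊞ₛ C')) ≫ f =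
      ((inl ⊗ₘ inl) ⊗ₘ inl) ≫ g)
    (h₂ : (((inl : A ⟶ A ⊞ₛ A') ⊗ₘ (inr : B' ⟶ B ⊞ₛ B')) ⊗ₘ (inl : C ⟶ C ⊞ₛ C')) ≫ f =
      ((inl ⊗ₘ inr) ⊗ₘ inl) ≫ g)
    (h₃ : (((inr : A' ⟶ A ⊞ₛ A') ⊗ₘ (inl : B ⟶ B ⊞ₛ B')) ⊗ₘ (inl : C ⟶ C ⊞ₛ C')) ≫ f =
      ((inr ⊗ₘ inl) ⊗ₘ inl) ≫ g)
    (h₄ : (((inr : A' ⟶ A ⊞ₛ A') ⊗ₘ (inr : B' ⟶ B ⊞ₛ B')) ⊗ₘ (inl : C ⟶ C ⊞ₛ C')) ≫ f =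
      ((inr ⊗ₘ inr) ⊗ₘ inl) ≫ g)
    (h₅ : (((inl : A ⟶ A ⊞ₛ A') ⊗ₘ (inl : B ⟶ B ⊞ₛ B')) ⊗ₘ (inr : C' ⟶ C ⊞ₛ C')) ≫ f =
      ((inl ⊗ₘ inl) ⊗ₘ inr) ≫ g)
    (h₆ : (((inl : A ⟶ A ⊞ₛ A') ⊗ₘ (inr : B' ⟶ B ⊞ₛ B')) ⊗ₘ (inr : C' ⟶ C ⊞ₛ C')) ≫ f =
      ((inl ⊗ₘ inr) ⊗ₘ inr) ≫ g)
    (h₇ : (((inr : A' ⟶ A ⊞ₛ A') ⊗ₘ (inl : B ⟶ B ⊞ₛ B')) ⊗ₘ (inr : C' ⟶ C ⊞ₛ C')) ≫ f =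
      ((inr ⊗ₘ inl) ⊗ₘ inr) ≫ g)
    (h₈ : (((inr : A' ⟶ A ⊞ₛ A') ⊗ₘ (inr : B' ⟶ B ⊞ₛ B')) ⊗ₘ (inr : C' ⟶ C ⊞ₛ C')) ≫ f =
      ((inr ⊗ₘ inr) ⊗ₘ inr) ≫ g) : f = g := by
  have aux : ∀ {P Q R S : H} {f g : (P ⊗ Q) ⊗ (C ⊞ₛ C') ⟶ W} (k : R ⟶ C ⊞ₛ C'),
    (α_ P Q R).inv ≫ (P ⊗ Q) ◁ k ≫ f = (α_ P Q R).inv ≫ (P ⊗ Q) ◁ k ≫ g →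
    (P ⊗ Q) ◁ k ≫ f = (P ⊗ Q) ◁ k ≫ g := fun k h => (cancel_epi _).1 h
  have aux2 : ∀ {R : H} (k : R ⟶ C ⊞ₛ C'),
    (((inl : A ⟶ A ⊞ₛ A') ⊗ₘ (inl : B ⟶ B ⊞ₛ B')) ⊗ₘ k) ≫ f = ((inl ⊗ₘ inl) ⊗ₘ k) ≫ g →
    (((inl : A ⟶ A ⊞ₛ A') ⊗ₘ (inr : B' ⟶ B ⊞ₛ B')) ⊗ₘ k) ≫ f = ((inl ⊗ₘ inr) ⊗ₘ k) ≫ g →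
    (((inr : A' ⟶ A ⊞ₛ A') ⊗ₘ (inl : B ⟶ B ⊞ₛ B')) ⊗ₘ k) ≫ f = ((inr ⊗ₘ inl) ⊗ₘ k) ≫ g →
    (((inr : A' ⟶ A ⊞ₛ A') ⊗ₘ (inr : B' ⟶ B ⊞ₛ B')) ⊗ₘ k) ≫ f = ((inr ⊗ₘ inr) ⊗ₘ k) ≫ g →
    _ ◁ k ≫ f = _ ◁ k ≫ g := by
    intro R k k₁ k₂ k₃ k₄
    -- commute the third factor to the front, then use extensionality there
    have e : ∀ {P Q : H} (i : P ⟶ A ⊞ₛ A') (j : Q ⟶ B ⊞ₛ B'),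
      ((i ⊗ₘ j) ⊗ₘ k) ≫ f = ((i ⊗ₘ j) ⊗ₘ k) ≫ g →
      i ▷ (Q ⊗ R) ≫ _ ◁ (j ▷ R) ≫ (α_ _ _ _).inv ≫ _ ◁ k ≫ f =
      i ▷ (Q ⊗ R) ≫ _ ◁ (j ▷ R) ≫ (α_ _ _ _).inv ≫ _ ◁ k ≫ g := by
      intro P Q i j h
      have e2 : i ▷ (Q ⊗ R) ≫ _ ◁ (j ▷ R) ≫ (α_ _ _ _).inv ≫ _ ◁ k =
        (α_ _ _ _).inv ≫ ((i ⊗ₘ j) ⊗ₘ k) := by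
        simp [MonoidalCategory.tensorHom_def]
      simpa only [assoc] using
        (show (i ▷ (Q ⊗ R) ≫ _ ◁ (j ▷ R) ≫ (α_ _ _ _).inv ≫ _ ◁ k) ≫ f =
          (i ▷ (Q ⊗ R) ≫ _ ◁ (j ▷ R) ≫ (α_ _ _ _).inv ≫ _ ◁ k) ≫ g by
          rw [e2, assoc, assoc, h])
    rw [← cancel_epi (α_ _ _ _).inv]
    rw [← cancel_epi (_ ◁ (distR B B' R).inv), ← cancel_epi (distL _ _ _).inv]
    refine desc_ext ?_ ?_
    · simp only [inl_distL_inv_assoc, ← whiskerLeft_comp_assoc, inl_distR_inv]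
      exact whiskerRight_desc_ext (e _ _ k₁) (e _ _ k₃)
    · simp only [inr_distL_inv_assoc, ← whiskerLeft_comp_assoc, inr_distR_inv]
      exact whiskerRight_desc_ext (e _ _ k₂) (e _ _ k₄)
  exact whiskerLeft_desc_ext (aux2 _ h₁ h₂ h₃ h₄) (aux2 _ h₅ h₆ h₇ h₈)

theorem tens_ll (X Y : H) :
    ((inl : X ⟶ _) ⊗ₘ (inl : Y ⟶ _)) ≫ (expand X Y).hom = inl ≫ inl := by
  rw [MonoidalCategory.tensorHom_def, assoc, expand_ll]
theorem tens_lr (X Y : H) :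
    ((inl : X ⟶ _) ⊗ₘ (inr : 𝟙_ H ⟶ _)) ≫ (expand X Y).hom =
      ((ρ_ X).hom ≫ inl ≫ inr) ≫ inl := by
  rw [MonoidalCategory.tensorHom_def, assoc, expand_lr, assoc, assoc]
theorem tens_rl (X Y : H) :
    ((inr : 𝟙_ H ⟶ _) ⊗ₘ (inl : Y ⟶ _)) ≫ (expand X Y).hom =
      ((λ_ Y).hom ≫ inr ≫ inr) ≫ inl := by
  rw [MonoidalCategory.tensorHom_def, assoc, expand_rl, assoc, assoc]
theorem tens_rr (X Y : H) :
    ((inr : 𝟙_ H ⟶ _) ⊗ₘ (inr : 𝟙_ H ⟶ _)) ≫ (expand X Y).hom = (λ_ (𝟙_ H)).hom ≫ inr := by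
  rw [MonoidalCategory.tensorHom_def, assoc, expand_rr]

section pre
variable {A B X Y W : H}

theorem pre_ll (f : A ⟶ X) (g : B ⟶ Y) (h : parObj X Y ⊞ₛ 𝟙_ H ⟶ W) :
    ((f ≫ inl) ⊗ₘ (g ≫ inl)) ≫ (expand X Y).hom ≫ h = (f ⊗ₘ g) ≫ inl ≫ inl ≫ h := by
  rw [← tensorHom_comp_tensorHom_assoc, ← assoc (inl ⊗ₘ inl), tens_ll, assoc]
theorem pre_lr (f : A ⟶ X) (g : B ⟶ 𝟙_ H) (h : parObj X Y ⊞ₛ 𝟙_ H ⟶ W) :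
    ((f ≫ inl) ⊗ₘ (g ≫ inr)) ≫ (expand X Y).hom ≫ h =
      (f ⊗ₘ g) ≫ (ρ_ X).hom ≫ inl ≫ inr ≫ inl ≫ h := by
  rw [← tensorHom_comp_tensorHom_assoc, ← assoc (inl ⊗ₘ inr), tens_lr, assoc, assoc, assoc]
theorem pre_rl (f : A ⟶ 𝟙_ H) (g : B ⟶ Y) (h : parObj X Y ⊞ₛ 𝟙_ H ⟶ W) :
    ((f ≫ inr) ⊗ₘ (g ≫ inl)) ≫ (expand X Y).hom ≫ h =
      (f ⊗ₘ g) ≫ (λ_ Y).hom ≫ inr ≫ inr ≫ inl ≫ h := by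
  rw [← tensorHom_comp_tensorHom_assoc, ← assoc (inr ⊗ₘ inl), tens_rl, assoc, assoc, assoc]
theorem pre_rr (f : A ⟶ 𝟙_ H) (g : B ⟶ 𝟙_ H) (h : parObj X Y ⊞ₛ 𝟙_ H ⟶ W) :
    ((f ≫ inr) ⊗ₘ (g ≫ inr)) ≫ (expand X Y).hom ≫ h = (f ⊗ₘ g) ≫ (λ_ (𝟙_ H)).hom ≫ inr ≫ h := by
  rw [← tensorHom_comp_tensorHom_assoc, ← assoc (inr ⊗ₘ inr), tens_rr, assoc]

end pre

theorem expand_par {X Y X' Y' : H} (f : X ⟶ X') (g : Y ⟶ Y') :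
    (sumMap f (𝟙 (𝟙_ H)) ⊗ₘ sumMap g (𝟙 (𝟙_ H))) ≫ (expand X' Y').hom =
      (expand X Y).hom ≫ sumMap (parMap f g) (𝟙 _) := by
  rw [← comp_id (expand X' Y').hom]
  refine tensor_ext ?_ ?_ ?_ ?_ <;>
    rw [tensorHom_comp_tensorHom_assoc, ← assoc _ (expand X Y).hom] <;>
    simp only [inl_sumMap, inr_sumMap, tens_ll, tens_lr, tens_rl, tens_rr, pre_ll, pre_lr, pre_rl, pre_rr] <;>
    simp [parMap, tensorHom_id, id_tensorHom]

theorem expand_swap (X Y : H)  :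
    (β_ (X ⊞ₛ 𝟙_ H) (Y ⊞ₛ 𝟙_ H)).hom ≫ (expand Y X).hom =
      (expand X Y).hom ≫ sumMap (parSwap X Y).hom (𝟙 _) := by
  refine tensor_ext ?_ ?_ ?_ ?_ <;>
    rw [BraidedCategory.braiding_naturality_assoc, ← assoc _ (expand X Y).hom] <;>
    simp only [tens_ll, tens_lr, tens_rl, tens_rr] <;>
    simp [parSwap]
  rw [unitors_equal]

theorem expand_assoc (X Y Z : H) :
    (expand X Y).hom ▷ (Z ⊞ₛ 𝟙_ H) ≫ (expand (parObj X Y) Z).hom ≫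
        sumMap (parAssoc X Y Z).hom (𝟙 _) =
      (α_ _ _ _).hom ≫ (X ⊞ₛ 𝟙_ H) ◁ (expand Y Z).hom ≫ (expand X (parObj Y Z)).hom := by
  rw [← tensorHom_id, ← id_tensorHom, ← comp_id (expand X (parObj Y Z)).hom]
  refine tensor_ext3 ?_ ?_ ?_ ?_ ?_ ?_ ?_ ?_ <;>
    rw [associator_naturality_assoc, tensorHom_comp_tensorHom_assoc, tensorHom_comp_tensorHom_assoc,
      comp_id, comp_id] <;>
    simp only [tens_ll, tens_lr, tens_rl, tens_rr]
  · rw [← id_comp (inl : Z ⟶ Z ⊞ₛ 𝟙_ H), pre_ll,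
      ← id_comp (inl : X ⟶ X ⊞ₛ 𝟙_ H), pre_ll]
    simp [parAssoc]
  · rw [← id_comp (inl : Z ⟶ Z ⊞ₛ 𝟙_ H), pre_ll,
      ← id_comp (inl : X ⟶ X ⊞ₛ 𝟙_ H), pre_ll]
    simp [parAssoc]
  · rw [← id_comp (inl : Z ⟶ Z ⊞ₛ 𝟙_ H), pre_ll,
      ← id_comp (inr : 𝟙_ H ⟶ X ⊞ₛ 𝟙_ H), pre_rl]
    simp [parAssoc]
  · rw [← id_comp (inl : Z ⟶ Z ⊞ₛ 𝟙_ H), pre_rl,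
      ← id_comp (inr : 𝟙_ H ⟶ X ⊞ₛ 𝟙_ H), pre_rl]
    simp [parAssoc]
  · rw [← id_comp (inr : 𝟙_ H ⟶ Z ⊞ₛ 𝟙_ H), pre_lr,
      ← id_comp (inl : X ⟶ X ⊞ₛ 𝟙_ H), pre_ll]
    simp [parAssoc]
  · rw [← id_comp (inr : 𝟙_ H ⟶ Z ⊞ₛ 𝟙_ H), pre_lr,
      ← id_comp (inl : X ⟶ X ⊞ₛ 𝟙_ H), pre_lr]
    simp [parAssoc]
  · rw [← id_comp (inr : 𝟙_ H ⟶ Z ⊞ₛ 𝟙_ H), pre_lr,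
      ← id_comp (inr : 𝟙_ H ⟶ X ⊞ₛ 𝟙_ H), pre_rl]
    simp [parAssoc]
  · rw [← id_comp (inr : 𝟙_ H ⟶ Z ⊞ₛ 𝟙_ H), pre_rr,
      ← id_comp (inr : 𝟙_ H ⟶ X ⊞ₛ 𝟙_ H), pre_rr]
    simp [parAssoc]
    have e : (ρ_ (𝟙_ H ⊗ 𝟙_ H)).hom ≫ (λ_ (𝟙_ H)).hom ≫ (ρ_ (𝟙_ H)).inv ≫ (λ_ (𝟙_ H)).hom =
        (α_ (𝟙_ H) (𝟙_ H) (𝟙_ H)).hom ≫ (λ_ (𝟙_ H ⊗ 𝟙_ H)).hom ≫ (λ_ (𝟙_ H)).hom := by monoidal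
    simpa only [assoc] using e =≫ inr

theorem expand_leftUnitor (X : H) :
    (zeroSum (𝟙_ H)).inv ▷ (X ⊞ₛ 𝟙_ H) ≫ (expand (zobj H) X).hom ≫
      sumMap (parLeftUnitor X).hom (𝟙 _) = (λ_ (X ⊞ₛ 𝟙_ H)).hom := by
  have h : ∀ {Z : H} (k : Z ⟶ X ⊞ₛ 𝟙_ H),
      _ ◁ k ≫ (zeroSum (𝟙_ H)).inv ▷ (X ⊞ₛ 𝟙_ H) ≫ (expand (zobj H) X).hom ≫
        sumMap (parLeftUnitor X).hom (𝟙 _) =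
      (inr ⊗ₘ k) ≫ (expand (zobj H) X).hom ≫ sumMap (parLeftUnitor X).hom (𝟙 _) := by
    intro Z k
    rw [whisker_exchange_assoc, MonoidalCategory.tensorHom_def]
    simp only [zeroSum_inv, assoc]
  refine whiskerLeft_desc_ext ?_ ?_
  · rw [h, ← assoc, tens_rl]
    simp [parLeftUnitor]
  · rw [h, ← assoc, tens_rr]
    simp

theorem expand_rightUnitor (X : H) :
    (X ⊞ₛ 𝟙_ H) ◁ (zeroSum (𝟙_ H)).inv ≫ (expand X (zobj H)).hom ≫
      sumMap (parRightUnitor X).hom (𝟙 _) = (ρ_ (X ⊞ₛ 𝟙_ H)).hom := by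
  have h : ∀ {Z : H} (k : Z ⟶ X ⊞ₛ 𝟙_ H),
      k ▷ _ ≫ (X ⊞ₛ 𝟙_ H) ◁ (zeroSum (𝟙_ H)).inv ≫ (expand X (zobj H)).hom ≫
        sumMap (parRightUnitor X).hom (𝟙 _) =
      (k ⊗ₘ inr) ≫ (expand X (zobj H)).hom ≫ sumMap (parRightUnitor X).hom (𝟙 _) := by
    intro Z k
    rw [MonoidalCategory.tensorHom_def]
    simp only [zeroSum_inv, assoc]
  refine whiskerRight_desc_ext ?_ ?_
  · rw [h, ← assoc, tens_lr]
    simp [parRightUnitor]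
  · rw [h, ← assoc, tens_rr]
    simp [unitors_equal]

theorem expand_par' {X Y X' Y' : H} (f : X ⟶ X') (g : Y ⟶ Y') :
    sumMap (parMap f g) (𝟙 (𝟙_ H)) = (expand X Y).inv ≫
      (sumMap f (𝟙 (𝟙_ H)) ⊗ₘ sumMap g (𝟙 (𝟙_ H))) ≫ (expand X' Y').hom := by
  rw [expand_par, Iso.inv_hom_id_assoc]

theorem expand_whiskerLeft (X : H) {Y Y' : H} (g : Y ⟶ Y') :
    sumMap (parMap (𝟙 X) g) (𝟙 (𝟙_ H)) = (expand X Y).inv ≫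
      ((X ⊞ₛ 𝟙_ H) ◁ sumMap g (𝟙 (𝟙_ H))) ≫ (expand X Y').hom := by
  rw [expand_par', sumMap_id, id_tensorHom]

theorem expand_whiskerRight {X X' : H} (f : X ⟶ X') (Y : H) :
    sumMap (parMap f (𝟙 Y)) (𝟙 (𝟙_ H)) = (expand X Y).inv ≫
      (sumMap f (𝟙 (𝟙_ H)) ▷ (Y ⊞ₛ 𝟙_ H)) ≫ (expand X' Y).hom := by
  rw [expand_par', sumMap_id, tensorHom_id]

theorem expand_assoc' (X Y Z : H) :
    sumMap (parAssoc X Y Z).hom (𝟙 (𝟙_ H)) =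
      (((expand (parObj X Y) Z).symm ≪≫ ((expand X Y).symm ⊗ᵢ .refl _)) ≪≫
        α_ (X ⊞ₛ 𝟙_ H) (Y ⊞ₛ 𝟙_ H) (Z ⊞ₛ 𝟙_ H) ≪≫
        ((.refl _ ⊗ᵢ expand Y Z) ≪≫ expand X (parObj Y Z))).hom := by
  have h := expand_assoc X Y Z
  simp only [Iso.trans_hom, Iso.symm_hom, tensorIso_hom, Iso.refl_hom, assoc, tensorHom_id,
    id_tensorHom]
  rw [← h, inv_hom_whiskerRight_assoc, Iso.inv_hom_id_assoc]

theorem expand_leftUnitor' (X : H) :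
    sumMap (parLeftUnitor X).hom (𝟙 (𝟙_ H)) =
      (((expand (zobj H) X).symm ≪≫ ((zeroSum (𝟙_ H)).symm.symm ⊗ᵢ .refl _)) ≪≫
        λ_ (X ⊞ₛ 𝟙_ H)).hom := by
  have h := expand_leftUnitor X
  simp only [Iso.trans_hom, Iso.symm_hom, Iso.symm_symm_eq, tensorIso_hom, Iso.refl_hom, assoc,
    tensorHom_id]
  rw [← h, hom_inv_whiskerRight_assoc, Iso.inv_hom_id_assoc]

theorem expand_rightUnitor' (X : H) :
    sumMap (parRightUnitor X).hom (𝟙 (𝟙_ H)) =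
      (((expand X (zobj H)).symm ≪≫ (.refl _ ⊗ᵢ (zeroSum (𝟙_ H)).symm.symm)) ≪≫
        ρ_ (X ⊞ₛ 𝟙_ H)).hom := by
  have h := expand_rightUnitor X
  simp only [Iso.trans_hom, Iso.symm_hom, Iso.symm_symm_eq, tensorIso_hom, Iso.refl_hom, assoc,
    id_tensorHom]
  rw [← h, whiskerLeft_hom_inv_assoc, Iso.inv_hom_id_assoc]

end Distributive

/-! ### The symmetric monoidal category `(H, |, 0)` -/

/-- The category `H`, regarded with the monoidal product `|`. -/
def ParCat (H : Type v) := H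

section Par

variable (H : Type v) [Category.{w} H] [MonoidalCategory H] [SymmetricCategory H]
  [Semiadditive H] [Distributive H]

instance : Category.{w} (ParCat H) := inferInstanceAs (Category.{w} H)

instance parStruct : MonoidalCategoryStruct (ParCat H) where
  tensorObj X Y := parObj (H := H) X Y
  tensorUnit := zobj H
  tensorHom f g := parMap (H := H) f g
  whiskerLeft X _ _ g := parMap (H := H) (𝟙 (X : H)) g
  whiskerRight f Y := parMap (H := H) f (𝟙 (Y : H))
  associator X Y Z := (parAssoc (H := H) X Y Z : _ ≅ _)
  leftUnitor X := (parLeftUnitor (H := H) X : _ ≅ _)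
  rightUnitor X := (parRightUnitor (H := H) X : _ ≅ _)

/-- The faithful functor `X ↦ X ⊕ 1`. -/
def parFunctor : ParCat H ⥤ H where
  obj X := osum (H := H) X (𝟙_ H)
  map f := sumMap (H := H) f (𝟙 (𝟙_ H))
  map_id X := sumMap_id (H := H) X (𝟙_ H)
  map_comp f g := by
    refine Eq.trans ?_ (sumMap_comp (H := H) f (𝟙 (𝟙_ H)) g (𝟙 (𝟙_ H))).symm
    rw [comp_id]; rfl

theorem sumMap_injective {X Y : H} {f g : X ⟶ Y}
    (h : sumMap f (𝟙 (𝟙_ H)) = sumMap g (𝟙 (𝟙_ H))) : f = g := by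
  have h' : inl ≫ sumMap f (𝟙 (𝟙_ H)) ≫ fst = inl ≫ sumMap g (𝟙 (𝟙_ H)) ≫ fst := by rw [h]
  simpa using h'

instance : (parFunctor H).Faithful where
  map_injective h := sumMap_injective H h

/-- The functor `X ↦ X ⊕ 1` carries the operations of `|` to those of `⊗`. -/
def parData : Monoidal.InducingFunctorData (parFunctor H) where
  μIso X Y := expand (H := H) X Y
  εIso := (zeroSum (𝟙_ H)).symm
  tensorHom_eq f g := expand_par' (H := H) f g
  whiskerLeft_eq X {_ _} f := expand_whiskerLeft (H := H) X f
  whiskerRight_eq f Y := expand_whiskerRight (H := H) f Y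
  associator_eq X Y Z := expand_assoc' (H := H) X Y Z
  leftUnitor_eq X := expand_leftUnitor' (H := H) X
  rightUnitor_eq X := expand_rightUnitor' (H := H) X

instance parMonoidal : MonoidalCategory (ParCat H) :=
  Monoidal.induced (parFunctor H) (parData H)

instance : (parFunctor H).Monoidal := Monoidal.fromInducedMonoidal (parFunctor H) (parData H)

instance parBraided : BraidedCategory (ParCat H) :=
  BraidedCategory.ofFaithful (parFunctor H) (fun X Y => parSwap (H := H) X Y)
    fun X Y => (expand_swap (H := H) X Y).symm

instance : (parFunctor H).Braided where
  braided X Y := (expand_swap (H := H) X Y).symm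

instance parSymmetric : SymmetricCategory (ParCat H) := SymmetricCategory.ofFaithful (parFunctor H)

end Par

/-! ### The symmetric monoidal category `H^{⊕1}` -/

/-- The category `H^{⊕1}`, with the objects of `H`. -/
def PlusOne (H : Type v) := H

/-- The morphisms of `H^{⊕1}` from `X` to `Y`: the morphisms `X ⊕ 1 ⟶ Y ⊕ 1` of `H` of the form
`g + ι_r ∘ π_r`. -/
@[ext] structure PlusOneHom {H : Type v} [Category.{w} H] [MonoidalCategory H] [Semiadditive H]
    (X Y : H) : Type w where
  /-- the underlying morphism of `H` -/
  val : X ⊞ₛ 𝟙_ H ⟶ Y ⊞ₛ 𝟙_ H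
  exists_eq_add : ∃ g : X ⊞ₛ 𝟙_ H ⟶ Y ⊞ₛ 𝟙_ H, val = g + snd ≫ inr

section PlusOne

variable {H : Type v} [Category.{w} H] [MonoidalCategory H] [SymmetricCategory H]
  [Semiadditive H] [Distributive H]

theorem exists_eq_add_iff {X Y : H} (f : X ⊞ₛ 𝟙_ H ⟶ Y ⊞ₛ 𝟙_ H) :
    (∃ g : X ⊞ₛ 𝟙_ H ⟶ Y ⊞ₛ 𝟙_ H, f = g + snd ≫ inr) ↔
      ∃ c : 𝟙_ H ⟶ 𝟙_ H, inr ≫ f ≫ snd = c + 𝟙 _ := by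
  constructor
  · rintro ⟨g, rfl⟩
    exact ⟨inr ≫ g ≫ snd, by simp [add_comp, comp_add]⟩
  · rintro ⟨c, hc⟩
    refine ⟨desc (inl ≫ f) (lift (inr ≫ f ≫ fst) c), ?_⟩
    refine desc_ext (by simp [comp_add]) (lift_ext ?_ ?_)
    · simp [comp_add, add_comp]
    · simp [comp_add, add_comp, hc]

/-- The functional morphism `f ⊕ id` of `H^{⊕1}`. -/
def PlusOneHom.functional {X Y : H} (f : X ⟶ Y) : PlusOneHom X Y where
  val := sumMap f (𝟙 _)
  exists_eq_add := (exists_eq_add_iff _).2 ⟨0, by simp⟩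

theorem expand_rr_inv (X Y : H) :
    inr ≫ (expand X Y).inv = (λ_ (𝟙_ H)).inv ≫ (inr ⊗ₘ inr) := by
  rw [Iso.comp_inv_eq, assoc, tens_rr, Iso.inv_hom_id_assoc]

theorem expand_snd (X Y : H) :
    (expand X Y).hom ≫ snd = (snd ⊗ₘ snd) ≫ (λ_ (𝟙_ H)).hom := by
  refine tensor_ext ?_ ?_ ?_ ?_ <;> rw [← assoc, ← assoc, tensorHom_comp_tensorHom]
  · rw [tens_ll]; simp [whiskerLeft_zero', MonoidalCategory.tensorHom_def]
  · rw [tens_lr]; simp [zero_whiskerRight', MonoidalCategory.tensorHom_def]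
  · rw [tens_rl]; simp [whiskerLeft_zero', MonoidalCategory.tensorHom_def]
  · rw [tens_rr]; simp

/-- The monoidal product of two morphisms of `H^{⊕1}`. -/
def PlusOneHom.tensor {X X' Y Y' : H} (f : PlusOneHom X X') (g : PlusOneHom Y Y') :
    PlusOneHom (parObj X Y) (parObj X' Y') where
  val := (expand X Y).inv ≫ (f.val ⊗ₘ g.val) ≫ (expand X' Y').hom
  exists_eq_add := by
    obtain ⟨c, hc⟩ := (exists_eq_add_iff _).1 f.exists_eq_add
    obtain ⟨d, hd⟩ := (exists_eq_add_iff _).1 g.exists_eq_add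
    refine (exists_eq_add_iff _).2 ⟨c ≫ d + c + d, ?_⟩
    have h : inr ≫ ((expand X Y).inv ≫ (f.val ⊗ₘ g.val) ≫ (expand X' Y').hom) ≫ snd =
        (λ_ (𝟙_ H)).inv ≫ ((inr ≫ f.val ≫ snd) ⊗ₘ (inr ≫ g.val ≫ snd)) ≫ (λ_ (𝟙_ H)).hom := by
      rw [assoc, assoc, expand_snd, ← assoc inr, expand_rr_inv]
      simp
    rw [h, hc, hd, MonoidalCategory.tensorHom_def, assoc, MonoidalCategory.leftUnitor_naturality]
    rw [MonoidalCategory.whiskerRight_id, unitors_equal, unitors_inv_equal]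
    simp [comp_add, add_comp]
    abel

/-- The identity of `H^{⊕1}`. -/
def PlusOneHom.id (X : H) : PlusOneHom X X where
  val := 𝟙 _
  exists_eq_add := (exists_eq_add_iff _).2 ⟨0, by simp⟩

/-- The composition of `H^{⊕1}`. -/
def PlusOneHom.comp {X Y Z : H} (f : PlusOneHom X Y) (g : PlusOneHom Y Z) : PlusOneHom X Z where
  val := f.val ≫ g.val
  exists_eq_add := by
    obtain ⟨a, ha⟩ := f.exists_eq_add
    obtain ⟨b, hb⟩ := g.exists_eq_add
    refine ⟨a ≫ b + a ≫ snd ≫ inr + snd ≫ inr ≫ b, ?_⟩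
    rw [ha, hb]
    simp [comp_add, add_comp]
    abel

variable (H)

instance plusOneCategory : Category.{w} (PlusOne H) where
  Hom X Y := PlusOneHom (H := H) X Y
  id X := PlusOneHom.id (H := H) X
  comp f g := PlusOneHom.comp (H := H) f g
  id_comp f := PlusOneHom.ext (id_comp _)
  comp_id f := PlusOneHom.ext (comp_id _)
  assoc f g h := PlusOneHom.ext (assoc _ _ _)

/-- The functor `f ↦ f ⊕ id` from `H` to `H^{⊕1}`. -/
def functionalFunctor : ParCat H ⥤ PlusOne H where
  obj X := X
  map f := PlusOneHom.functional (H := H) f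
  map_id X := PlusOneHom.ext ((parFunctor H).map_id X)
  map_comp f g := PlusOneHom.ext ((parFunctor H).map_comp f g)

instance plusOneStruct : MonoidalCategoryStruct (PlusOne H) where
  tensorObj X Y := parObj (H := H) X Y
  tensorUnit := zobj H
  tensorHom f g := PlusOneHom.tensor (H := H) f g
  whiskerLeft X _ _ g := PlusOneHom.tensor (H := H) (PlusOneHom.id (H := H) X) g
  whiskerRight f Y := PlusOneHom.tensor (H := H) f (PlusOneHom.id (H := H) Y)
  associator X Y Z := (functionalFunctor H).mapIso ((parStruct H).associator X Y Z)
  leftUnitor X := (functionalFunctor H).mapIso ((parStruct H).leftUnitor X)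
  rightUnitor X := (functionalFunctor H).mapIso ((parStruct H).rightUnitor X)

/-- The faithful functor from `H^{⊕1}` to `H` given by `X ↦ X ⊕ 1`. -/
def plusOneFunctor : PlusOne H ⥤ H where
  obj X := osum (H := H) X (𝟙_ H)
  map f := f.val
  map_id _ := rfl
  map_comp _ _ := rfl

instance : (plusOneFunctor H).Faithful where
  map_injective h := PlusOneHom.ext h

/-- The functor `X ↦ X ⊕ 1` carries the operations of `H^{⊕1}` to those of `⊗`. -/
def plusOneData : Monoidal.InducingFunctorData (plusOneFunctor H) where
  μIso X Y := expand (H := H) X Y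
  εIso := (zeroSum (𝟙_ H)).symm
  tensorHom_eq f g := rfl
  whiskerLeft_eq X {Y Z} f := by
    exact congrArg (fun k => (expand (H := H) X Y).inv ≫ k ≫ (expand (H := H) X Z).hom)
      (id_tensorHom (osum (H := H) X (𝟙_ H)) f.val)
  whiskerRight_eq {X Y} f Z := by
    exact congrArg (fun k => (expand (H := H) X Z).inv ≫ k ≫ (expand (H := H) Y Z).hom)
      (tensorHom_id f.val (osum (H := H) Z (𝟙_ H)))
  associator_eq X Y Z := expand_assoc' (H := H) X Y Z
  leftUnitor_eq X := expand_leftUnitor' (H := H) X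
  rightUnitor_eq X := expand_rightUnitor' (H := H) X

instance plusOneMonoidal : MonoidalCategory (PlusOne H) :=
  Monoidal.induced (plusOneFunctor H) (plusOneData H)

instance : (plusOneFunctor H).Monoidal :=
  Monoidal.fromInducedMonoidal (plusOneFunctor H) (plusOneData H)

instance plusOneBraided : BraidedCategory (PlusOne H) :=
  BraidedCategory.ofFaithful (plusOneFunctor H)
    (fun X Y => (functionalFunctor H).mapIso ((parBraided H).braiding X Y))
    fun X Y => (expand_swap (H := H) X Y).symm

instance : (plusOneFunctor H).Braided where
  braided X Y := (expand_swap (H := H) X Y).symm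

instance plusOneSymmetric : SymmetricCategory (PlusOne H) :=
  SymmetricCategory.ofFaithful (plusOneFunctor H)

end PlusOne

/-! ### Colors -/

/-- The colors `A ::= 0 | 1 | A ⊕ A | A ⊗ A`. -/
inductive Color : Type
  | zero : Color
  | one : Color
  | plus : Color → Color → Color
  | tensor : Color → Color → Color

/-- The derivations of `A ≈ A'`, where `≈` is the congruence generated by the unit laws and
associativity of `⊕` and of `⊗`. -/
inductive ColorPath : Color → Color → Type
  | refl (A : Color) : ColorPath A A
  | symm {A B : Color} : ColorPath A B → ColorPath B A
  | trans {A B C : Color} : ColorPath A B → ColorPath B C → ColorPath A C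
  | zeroPlus (A : Color) : ColorPath (.plus .zero A) A
  | plusZero (A : Color) : ColorPath (.plus A .zero) A
  | oneTensor (A : Color) : ColorPath (.tensor .one A) A
  | tensorOne (A : Color) : ColorPath (.tensor A .one) A
  | plusAssoc (A B C : Color) : ColorPath (.plus (.plus A B) C) (.plus A (.plus B C))
  | tensorAssoc (A B C : Color) : ColorPath (.tensor (.tensor A B) C) (.tensor A (.tensor B C))
  | plus {A B A' B' : Color} : ColorPath A A' → ColorPath B B' →
      ColorPath (.plus A B) (.plus A' B')
  | tensor {A B A' B' : Color} : ColorPath A A' → ColorPath B B' →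
      ColorPath (.tensor A B) (.tensor A' B')

/-- The relation `A ≈ A'` on colors. -/
def ColorEquiv (A B : Color) : Prop := Nonempty (ColorPath A B)

section ColorSemantics

variable (H : Type v) [Category.{w} H] [MonoidalCategory H] [SymmetricCategory H]
  [Semiadditive H] [Distributive H]

/-- The object `⟦A⟧` of `H`. -/
def semColor : Color → H
  | .zero => zobj H
  | .one => 𝟙_ H
  | .plus A B => semColor A ⊞ₛ semColor B
  | .tensor A B => semColor A ⊗ semColor B

/-- The isomorphism `⟦A⟧ ≅ ⟦A'⟧` composed of unitors and associators, along a derivation of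
`A ≈ A'`. -/
def ColorPath.sem : {A B : Color} → ColorPath A B → (semColor H A ≅ semColor H B)
  | _, _, .refl A => Iso.refl (semColor H A)
  | _, _, .symm p => p.sem.symm
  | _, _, .trans p q => p.sem ≪≫ q.sem
  | _, _, .zeroPlus A => zeroSum (semColor H A)
  | _, _, .plusZero A => sumZero (semColor H A)
  | _, _, .oneTensor A => λ_ (semColor H A)
  | _, _, .tensorOne A => ρ_ (semColor H A)
  | _, _, .plusAssoc A B C => sumAssoc (semColor H A) (semColor H B) (semColor H C)
  | _, _, .tensorAssoc A B C => α_ (semColor H A) (semColor H B) (semColor H C)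
  | _, _, .plus p q => sumIso p.sem q.sem
  | _, _, .tensor p q => p.sem ⊗ᵢ q.sem

/-- The coordinate inclusions of a biproduct. -/
def plusPoints {X Y : H} (xs : List (𝟙_ H ⟶ X)) (ys : List (𝟙_ H ⟶ Y)) : List (𝟙_ H ⟶ X ⊞ₛ Y) :=
  xs.map (fun x => x ≫ inl) ++ ys.map (fun y => y ≫ inr)

/-- The coordinate inclusions of a tensor product. -/
def tensorPoints {X Y : H} (xs : List (𝟙_ H ⟶ X)) (ys : List (𝟙_ H ⟶ Y)) : List (𝟙_ H ⟶ X ⊗ Y) :=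
  xs.flatMap fun x => ys.map fun y => (λ_ (𝟙_ H)).inv ≫ (x ⊗ₘ y)

/-- Postcomposition with a morphism. -/
def pushPoints {X Y : H} (f : X ⟶ Y) (xs : List (𝟙_ H ⟶ X)) : List (𝟙_ H ⟶ Y) :=
  xs.map fun x => x ≫ f

/-- The coordinate inclusions `1 ⟶ ⟦A⟧`. -/
def points : (A : Color) → List (𝟙_ H ⟶ semColor H A)
  | .zero => []
  | .one => [𝟙 (𝟙_ H)]
  | .plus A B => plusPoints H (points A) (points B)
  | .tensor A B => tensorPoints H (points A) (points B)

/-- A list of points of `X` is jointly epic after tensoring with any object. -/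
def JointlyEpic {X : H} (xs : List (𝟙_ H ⟶ X)) : Prop :=
  ∀ {Z W : H} {f g : X ⊗ Z ⟶ W}, (∀ x ∈ xs, x ▷ Z ≫ f = x ▷ Z ≫ g) → f = g

theorem JointlyEpic.plus {X Y : H} {xs : List (𝟙_ H ⟶ X)} {ys : List (𝟙_ H ⟶ Y)}
    (hx : JointlyEpic H xs) (hy : JointlyEpic H ys) : JointlyEpic H (plusPoints H xs ys) := by
  intro Z W f g h
  refine whiskerRight_desc_ext (hx fun x h' => ?_) (hy fun y h' => ?_)
  · have := h (x ≫ inl) (by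
      simp only [plusPoints, List.mem_append, List.mem_map]; exact Or.inl ⟨x, h', rfl⟩)
    simpa using this
  · have := h (y ≫ inr) (by
      simp only [plusPoints, List.mem_append, List.mem_map]; exact Or.inr ⟨y, h', rfl⟩)
    simpa using this

theorem JointlyEpic.tensor {X Y : H} {xs : List (𝟙_ H ⟶ X)} {ys : List (𝟙_ H ⟶ Y)}
    (hx : JointlyEpic H xs) (hy : JointlyEpic H ys) : JointlyEpic H (tensorPoints H xs ys) := by
  intro Z W f g h
  rw [← cancel_epi (α_ X Y Z).inv]
  refine hx fun x h₁ => ?_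
  rw [← cancel_epi (λ_ (Y ⊗ Z)).inv]
  refine hy fun y h₂ => ?_
  have := h ((λ_ (𝟙_ H)).inv ≫ (x ⊗ₘ y)) (by
    simp only [tensorPoints, List.mem_flatMap, List.mem_map]; exact ⟨x, h₁, y, h₂, rfl⟩)
  have e : ∀ k : (X ⊗ Y) ⊗ Z ⟶ W,
      y ▷ Z ≫ (λ_ (Y ⊗ Z)).inv ≫ x ▷ (Y ⊗ Z) ≫ (α_ X Y Z).inv ≫ k =
      ((λ_ (𝟙_ H)).inv ≫ (x ⊗ₘ y)) ▷ Z ≫ k := by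
    intro k
    rw [MonoidalCategory.tensorHom_def']
    simp
  rw [e, e]
  exact this

theorem points_jointlyEpic : (A : Color) → JointlyEpic H (points H A)
  | .zero => fun _ => (isZero_zobj_tensor _).eq_of_src _ _
  | .one => fun h => (cancel_epi (𝟙 (𝟙_ H) ▷ _)).1 (h (𝟙 (𝟙_ H)) (List.mem_singleton.2 rfl))
  | .plus A B => JointlyEpic.plus H (points_jointlyEpic A) (points_jointlyEpic B)
  | .tensor A B => JointlyEpic.tensor H (points_jointlyEpic A) (points_jointlyEpic B)

theorem JointlyEpic.ext {X W : H} {xs : List (𝟙_ H ⟶ X)} (hx : JointlyEpic H xs) {f g : X ⟶ W}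
    (h : ∀ x ∈ xs, x ≫ f = x ≫ g) : f = g := by
  have : (ρ_ X).hom ≫ f = (ρ_ X).hom ≫ g := hx fun x h' => by
    rw [rightUnitor_naturality_assoc, rightUnitor_naturality_assoc, h x h']
  exact (cancel_epi _).1 this

theorem push_id {X : H} (xs : List (𝟙_ H ⟶ X)) : pushPoints H (𝟙 X) xs = xs := by
  simp [pushPoints]

theorem push_comp {X Y Z : H} (f : X ⟶ Y) (g : Y ⟶ Z) (xs : List (𝟙_ H ⟶ X)) :
    pushPoints H (f ≫ g) xs = pushPoints H g (pushPoints H f xs) := by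
  simp [pushPoints, Function.comp_def]

theorem push_sumMap {X Y X' Y' : H} (f : X ⟶ X') (g : Y ⟶ Y') (xs : List (𝟙_ H ⟶ X))
    (ys : List (𝟙_ H ⟶ Y)) : pushPoints H (sumMap f g) (plusPoints H xs ys) =
      plusPoints H (pushPoints H f xs) (pushPoints H g ys) := by
  simp [pushPoints, plusPoints, Function.comp_def]

theorem push_tensorHom {X Y X' Y' : H} (f : X ⟶ X') (g : Y ⟶ Y') (xs : List (𝟙_ H ⟶ X))
    (ys : List (𝟙_ H ⟶ Y)) : pushPoints H (f ⊗ₘ g) (tensorPoints H xs ys) =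
      tensorPoints H (pushPoints H f xs) (pushPoints H g ys) := by
  simp [pushPoints, tensorPoints, Function.comp_def, List.map_flatMap, List.flatMap_map]

theorem push_zeroSum {X : H} (xs : List (𝟙_ H ⟶ X)) :
    pushPoints H (zeroSum X).hom (plusPoints H [] xs) = xs := by
  simp [pushPoints, plusPoints, Function.comp_def]

theorem push_sumZero {X : H} (xs : List (𝟙_ H ⟶ X)) :
    pushPoints H (sumZero X).hom (plusPoints H xs []) = xs := by
  simp [pushPoints, plusPoints, Function.comp_def]

theorem push_leftUnitor {X : H} (xs : List (𝟙_ H ⟶ X)) :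
    pushPoints H (λ_ X).hom (tensorPoints H [𝟙 _] xs) = xs := by
  simp [pushPoints, tensorPoints, Function.comp_def]

theorem push_rightUnitor {X : H} (xs : List (𝟙_ H ⟶ X)) :
    pushPoints H (ρ_ X).hom (tensorPoints H xs [𝟙 _]) = xs := by
  simp [pushPoints, tensorPoints, List.map_flatMap, unitors_inv_equal]

theorem push_sumAssoc {X Y Z : H} (xs : List (𝟙_ H ⟶ X)) (ys : List (𝟙_ H ⟶ Y))
    (zs : List (𝟙_ H ⟶ Z)) :
    pushPoints H (sumAssoc X Y Z).hom (plusPoints H (plusPoints H xs ys) zs) =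
      plusPoints H xs (plusPoints H ys zs) := by
  have h₁ : (inl : X ⟶ X ⊞ₛ Y) ≫ inl ≫ (sumAssoc X Y Z).hom = inl :=
    lift_ext (by simp [sumAssoc]) (lift_ext (by simp [sumAssoc]) (by simp [sumAssoc]))
  have h₂ : (inr : Y ⟶ X ⊞ₛ Y) ≫ inl ≫ (sumAssoc X Y Z).hom = inl ≫ inr :=
    lift_ext (by simp [sumAssoc]) (lift_ext (by simp [sumAssoc]) (by simp [sumAssoc]))
  have h₃ : inr ≫ (sumAssoc X Y Z).hom = inr ≫ inr :=
    lift_ext (by simp [sumAssoc]) (lift_ext (by simp [sumAssoc]) (by simp [sumAssoc]))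
  simp [pushPoints, plusPoints, Function.comp_def, h₁, h₂, h₃]

theorem push_associator {X Y Z : H} (xs : List (𝟙_ H ⟶ X)) (ys : List (𝟙_ H ⟶ Y))
    (zs : List (𝟙_ H ⟶ Z)) :
    pushPoints H (α_ X Y Z).hom (tensorPoints H (tensorPoints H xs ys) zs) =
      tensorPoints H xs (tensorPoints H ys zs) := by
  have h : ∀ (x : 𝟙_ H ⟶ X) (y : 𝟙_ H ⟶ Y) (z : 𝟙_ H ⟶ Z),
      (λ_ (𝟙_ H)).inv ≫ (((λ_ (𝟙_ H)).inv ≫ (x ⊗ₘ y)) ⊗ₘ z) ≫ (α_ X Y Z).hom =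
        (λ_ (𝟙_ H)).inv ≫ (x ⊗ₘ ((λ_ (𝟙_ H)).inv ≫ (y ⊗ₘ z))) := by
    intro x y z
    have e : (λ_ (𝟙_ H)).inv ▷ 𝟙_ H ≫ (α_ (𝟙_ H) (𝟙_ H) (𝟙_ H)).hom = 𝟙_ H ◁ (λ_ (𝟙_ H)).inv := by
      monoidal
    have h₁ : (((λ_ (𝟙_ H)).inv ≫ (x ⊗ₘ y)) ⊗ₘ z) =
        (λ_ (𝟙_ H)).inv ▷ 𝟙_ H ≫ ((x ⊗ₘ y) ⊗ₘ z) := by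
      rw [← tensorHom_id, tensorHom_comp_tensorHom, id_comp]
    have h₂ : (x ⊗ₘ ((λ_ (𝟙_ H)).inv ≫ (y ⊗ₘ z))) =
        𝟙_ H ◁ (λ_ (𝟙_ H)).inv ≫ (x ⊗ₘ (y ⊗ₘ z)) := by
      rw [← id_tensorHom, tensorHom_comp_tensorHom, id_comp]
    rw [h₁, h₂, assoc, associator_naturality, ← e, assoc]
  simp [pushPoints, tensorPoints, Function.comp_def, List.map_flatMap, List.flatMap_map,
    List.flatMap_assoc, h]

theorem push_sem : {A B : Color} → (p : ColorPath A B) →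
    pushPoints H (p.sem H).hom (points H A) = points H B
  | _, _, .refl _ => push_id H _
  | _, _, .symm p =>
    (congrArg (pushPoints H (p.sem H).inv) (push_sem p)).symm.trans
      ((push_comp H _ _ _).symm.trans
        ((congrArg (fun k => pushPoints H k _) (p.sem H).hom_inv_id).trans (push_id H _)))
  | _, _, .trans p q =>
    (push_comp H _ _ _).trans ((congrArg _ (push_sem p)).trans (push_sem q))
  | _, _, .zeroPlus _ => push_zeroSum H _
  | _, _, .plusZero _ => push_sumZero H _
  | _, _, .oneTensor _ => push_leftUnitor H _
  | _, _, .tensorOne _ => push_rightUnitor H _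
  | _, _, .plusAssoc _ _ _ => push_sumAssoc H _ _ _
  | _, _, .tensorAssoc _ _ _ => push_associator H _ _ _
  | _, _, .plus p q =>
    (push_sumMap H _ _ _ _).trans (congrArg₂ (plusPoints H) (push_sem p) (push_sem q))
  | _, _, .tensor p q =>
    (push_tensorHom H _ _ _ _).trans (congrArg₂ (tensorPoints H) (push_sem p) (push_sem q))

/-- The isomorphism does not depend on the derivation. -/
theorem ColorPath.sem_unique {A B : Color} (p q : ColorPath A B) : p.sem H = q.sem H := by
  refine Iso.ext (JointlyEpic.ext H (points_jointlyEpic H A) ?_)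
  have := (push_sem H p).trans (push_sem H q).symm
  exact List.map_inj_left.1 this

/-- The unique structural isomorphism `⟦A ≈ A'⟧`. -/
def adapterIso {A B : Color} (h : ColorEquiv A B) : semColor H A ≅ semColor H B :=
  (Classical.choice h).sem H

theorem adapterIso_eq {A B : Color} (p : ColorPath A B) : adapterIso H ⟨p⟩ = p.sem H :=
  ColorPath.sem_unique H _ _

end ColorSemantics

/-! ### String diagrams over a colored signature -/

section Diagrams

variable {C : Type} (G : List C → List C → Type u)

/-- String diagrams with generators `G`: terms built from generators, identities and symmetries
by sequential and parallel composition. Identities and symmetries are those of lists of wires;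
modulo the equations below, they are composites of those of single wires. -/
inductive Diag : List C → List C → Type u
  | gen {X Y : List C} : G X Y → Diag X Y
  | id (X : List C) : Diag X X
  | swap (X Y : List C) : Diag (X ++ Y) (Y ++ X)
  | comp {X Y Z : List C} : Diag X Y → Diag Y Z → Diag X Z
  | par {X Y X' Y' : List C} : Diag X Y → Diag X' Y' → Diag (X ++ X') (Y ++ Y')

variable {G}

/-- Transport along equalities of lists. -/
def Diag.cast {X Y X' Y' : List C} (hX : X = X') (hY : Y = Y') (d : Diag G X Y) : Diag G X' Y' :=
  hX ▸ hY ▸ d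

variable (G)

/-- The equations of a PROP, that is, of a strict symmetric monoidal category whose objects are
lists and whose tensor product on objects is concatenation. -/
inductive DiagRel : {X Y : List C} → Diag G X Y → Diag G X Y → Prop
  | refl {X Y : List C} (d : Diag G X Y) : DiagRel d d
  | symm {X Y : List C} {d e : Diag G X Y} : DiagRel d e → DiagRel e d
  | trans {X Y : List C} {d e f : Diag G X Y} : DiagRel d e → DiagRel e f → DiagRel d f
  | comp_congr {X Y Z : List C} {d d' : Diag G X Y} {e e' : Diag G Y Z} :
      DiagRel d d' → DiagRel e e' → DiagRel (.comp d e) (.comp d' e')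
  | par_congr {X Y X' Y' : List C} {d d' : Diag G X Y} {e e' : Diag G X' Y'} :
      DiagRel d d' → DiagRel e e' → DiagRel (.par d e) (.par d' e')
  | id_comp {X Y : List C} (d : Diag G X Y) : DiagRel (.comp (.id X) d) d
  | comp_id {X Y : List C} (d : Diag G X Y) : DiagRel (.comp d (.id Y)) d
  | assoc {X Y Z W : List C} (d : Diag G X Y) (e : Diag G Y Z) (f : Diag G Z W) :
      DiagRel (.comp (.comp d e) f) (.comp d (.comp e f))
  | par_id (X Y : List C) : DiagRel (.par (.id X) (.id Y)) (.id (X ++ Y))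
  | interchange {X Y Z X' Y' Z' : List C} (d : Diag G X Y) (e : Diag G Y Z) (d' : Diag G X' Y')
      (e' : Diag G Y' Z') :
      DiagRel (.par (.comp d e) (.comp d' e')) (.comp (.par d d') (.par e e'))
  | nil_par {X Y : List C} (d : Diag G X Y) :
      DiagRel (.par (.id []) d) (d.cast (List.nil_append X).symm (List.nil_append Y).symm)
  | par_nil {X Y : List C} (d : Diag G X Y) :
      DiagRel (.par d (.id [])) (d.cast (List.append_nil X).symm (List.append_nil Y).symm)
  | par_assoc {X Y X' Y' X'' Y'' : List C} (d : Diag G X Y) (d' : Diag G X' Y')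
      (d'' : Diag G X'' Y'') :
      DiagRel (.par (.par d d') d'')
        ((Diag.par d (.par d' d'')).cast (List.append_assoc X X' X'').symm
          (List.append_assoc Y Y' Y'').symm)
  | swap_swap (X Y : List C) : DiagRel (.comp (.swap X Y) (.swap Y X)) (.id (X ++ Y))
  | swap_natural {X Y X' Y' : List C} (d : Diag G X Y) (e : Diag G X' Y') :
      DiagRel (.comp (.par d e) (.swap Y Y')) (.comp (.swap X X') (.par e d))
  | hexagon (X Y Z : List C) :
      DiagRel (.swap X (Y ++ Z))
        (.comp
          ((Diag.par (.swap X Y) (.id Z)).cast (List.append_assoc X Y Z) (List.append_assoc Y X Z))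
          ((Diag.par (.id Y) (.swap X Z)).cast rfl (List.append_assoc Y Z X).symm))

/-- Equality of string diagrams modulo the equations of a PROP. -/
def diagSetoid (X Y : List C) : Setoid (Diag G X Y) where
  r := DiagRel G
  iseqv := ⟨.refl, .symm, .trans⟩

/-- The morphisms `X ⟶ Y` of the free colored PROP on the generators `G`. -/
def PropHom (X Y : List C) : Type u := Quotient (diagSetoid G X Y)

variable {G}

/-- The class of a string diagram. -/
def PropHom.mk {X Y : List C} (d : Diag G X Y) : PropHom G X Y := Quotient.mk (diagSetoid G X Y) d

end Diagrams

/-! ### Interpretation of string diagrams in a symmetric monoidal category -/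

/-- The product `(⋯((a · c A₁) · c A₂) ⋯) · c Aₙ` for a binary operation `·`. -/
def foldObj {D : Type v} {C : Type} (op : D → D → D) (c : C → D) (a : D) : List C → D
  | [] => a
  | A :: X => foldObj op c (op a (c A)) X

/-- The object `⟦[A₁, …, Aₙ]⟧ = (⋯(c A₁ · c A₂) ⋯) · c Aₙ`, with `⟦[]⟧ = e` and
`⟦[A]⟧ = c A`. -/
def listObj {D : Type v} {C : Type} (op : D → D → D) (e : D) (c : C → D) : List C → D
  | [] => e
  | A :: X => foldObj op c (c A) X

theorem listObj_nil {D : Type v} {C : Type} (op : D → D → D) (e : D) (c : C → D) :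
    listObj op e c [] = e := rfl

theorem listObj_singleton {D : Type v} {C : Type} (op : D → D → D) (e : D) (c : C → D) (A : C) :
    listObj op e c [A] = c A := rfl

theorem foldObj_append {D : Type v} {C : Type} (op : D → D → D) (c : C → D) (B : C) :
    (X : List C) → (a : D) → foldObj op c a (X ++ [B]) = op (foldObj op c a X) (c B)
  | [], _ => rfl
  | _ :: X, _ => foldObj_append op c B X _

theorem listObj_append {D : Type v} {C : Type} (op : D → D → D) (e : D) (c : C → D) (A : C)
    (X : List C) (B : C) :
    listObj op e c ((A :: X) ++ [B]) = op (listObj op e c (A :: X)) (c B) :=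
  foldObj_append op c B X (c A)

/-- The product `c A₁ · (c A₂ · (⋯ · (c Aₙ · e)))`. -/
def rightObj {D : Type v} {C : Type} (op : D → D → D) (e : D) (c : C → D) : List C → D
  | [] => e
  | A :: X => op (c A) (rightObj op e c X)

section Interpretation

variable {D : Type v} [Category.{w} D] [MonoidalCategory D] [SymmetricCategory D]
variable {C : Type} (c : C → D)

/-- The object `⟦X⟧` of a monoidal category `D`, bracketed to the left. -/
abbrev monObj (X : List C) : D := listObj (fun a b : D => a ⊗ b) (𝟙_ D) c X

/-- The object `⟦X⟧` of a monoidal category `D`, bracketed to the right. -/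
abbrev monRight (X : List C) : D := rightObj (fun a b : D => a ⊗ b) (𝟙_ D) c X

/-- The structural isomorphism `foldObj (fun a b : D => a ⊗ b) c a X ≅ a ⊗ monRight c X`. -/
def foldIso : (a : D) → (X : List C) → (foldObj (fun a b : D => a ⊗ b) c a X ≅ a ⊗ monRight c X)
  | a, [] => (ρ_ a).symm
  | a, A :: X => foldIso (a ⊗ c A) X ≪≫ α_ a (c A) (monRight c X)

/-- The structural isomorphism between the two bracketings. -/
def listIso : (X : List C) → (monObj c X ≅ monRight c X)
  | [] => Iso.refl (𝟙_ D)
  | A :: X => foldIso c (c A) X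

/-- The structural isomorphism for concatenation of right bracketed products. -/
def rightAppend : (X Y : List C) → (monRight c (X ++ Y) ≅ monRight c X ⊗ monRight c Y)
  | [], Y => (λ_ (monRight c Y)).symm
  | A :: X, Y => whiskerLeftIso (c A) (rightAppend X Y) ≪≫
      (α_ (c A) (monRight c X) (monRight c Y)).symm

/-- The structural isomorphism `m : ⟦X ++ Y⟧ ≅ ⟦X⟧ ⊗ ⟦Y⟧`. -/
def listAppend (X Y : List C) : monObj c (X ++ Y) ≅ monObj c X ⊗ monObj c Y :=
  listIso c (X ++ Y) ≪≫ rightAppend c X Y ≪≫ ((listIso c X).symm ⊗ᵢ (listIso c Y).symm)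

theorem rightAppend_nil_step (a : D) {x y : D} (r : y ⟶ x ⊗ 𝟙_ D) :
    (a ◁ r ≫ (α_ a x (𝟙_ D)).inv) ≫ (ρ_ (a ⊗ x)).hom = a ◁ (r ≫ (ρ_ x).hom) := by
  simp

theorem rightAppend_assoc_step (a : D) {x y z xy yz xyz xyz' : D} (p : xyz ⟶ xy ⊗ z)
    (q : xy ⟶ x ⊗ y) (e : xyz ⟶ xyz') (s : xyz' ⟶ x ⊗ yz) (t : yz ⟶ y ⊗ z)
    (h : p ≫ q ▷ z ≫ (α_ x y z).hom = e ≫ s ≫ x ◁ t) :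
    (a ◁ p ≫ (α_ a xy z).inv) ≫ (a ◁ q ≫ (α_ a x y).inv) ▷ z ≫ (α_ (a ⊗ x) y z).hom =
      a ◁ e ≫ (a ◁ s ≫ (α_ a x yz).inv) ≫ (a ⊗ x) ◁ t := by
  have h₁ : a ◁ e ≫ (a ◁ s ≫ (α_ a x yz).inv) ≫ (a ⊗ x) ◁ t =
      a ◁ (e ≫ s ≫ x ◁ t) ≫ (α_ a x (y ⊗ z)).inv := by simp
  rw [h₁, ← h]
  simp

theorem eqToHom_cons {A : C} {X Y : List C} (h : X = Y) :
    eqToHom (congrArg (fun Z => monRight c (A :: Z)) h) =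
      c A ◁ eqToHom (congrArg (monRight c) h) := by
  subst h
  exact (whiskerLeft_id _ _).symm

theorem rightAppend_nil : (X : List C) →
    (rightAppend c X []).hom ≫ (ρ_ (monRight c X)).hom =
      eqToHom (congrArg (monRight c) (List.append_nil X))
  | [] => by
    refine (congrArg _ (unitors_equal (C := D)).symm).trans ?_
    exact (λ_ (𝟙_ D)).inv_hom_id
  | A :: X =>
    (rightAppend_nil_step (c A) (rightAppend c X []).hom).trans
      ((congrArg _ (rightAppend_nil X)).trans (eqToHom_cons c (List.append_nil X)).symm)

theorem rightAppend_assoc : (X Y Z : List C) →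
    (rightAppend c (X ++ Y) Z).hom ≫ (rightAppend c X Y).hom ▷ monRight c Z ≫
      (α_ (monRight c X) (monRight c Y) (monRight c Z)).hom =
    eqToHom (congrArg (monRight c) (List.append_assoc X Y Z)) ≫
      (rightAppend c X (Y ++ Z)).hom ≫ monRight c X ◁ (rightAppend c Y Z).hom
  | [], Y, Z => by
    refine Eq.trans ?_ (id_comp _).symm
    change (rightAppend c Y Z).hom ≫ (λ_ (monRight c Y)).inv ▷ monRight c Z ≫
      (α_ (𝟙_ D) (monRight c Y) (monRight c Z)).hom =
      (λ_ (monRight c (Y ++ Z))).inv ≫ 𝟙_ D ◁ (rightAppend c Y Z).hom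
    simp
  | A :: X, Y, Z =>
    (rightAppend_assoc_step (c A) (rightAppend c (X ++ Y) Z).hom (rightAppend c X Y).hom _
      (rightAppend c X (Y ++ Z)).hom (rightAppend c Y Z).hom (rightAppend_assoc X Y Z)).trans
      (congrArg (· ≫ _) (eqToHom_cons c (List.append_assoc X Y Z)).symm)

theorem listIso_eqToHom {X Y : List C} (h : X = Y) :
    (listIso c X).hom ≫ eqToHom (congrArg (monRight c) h) =
      eqToHom (congrArg (monObj c) h) ≫ (listIso c Y).hom := by
  subst h; simp

theorem listAppend_nil_left (X : List C) :
    (listAppend c [] X).hom = (λ_ (monObj c X)).inv := by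
  change (listIso c X).hom ≫ (λ_ (monRight c X)).inv ≫ (𝟙 (𝟙_ D) ⊗ₘ (listIso c X).inv) = _
  simp

theorem listAppend_nil_right_step {p q x y : D} (a : p ⟶ q) (r : q ⟶ x ⊗ 𝟙_ D) (b : x ⟶ y) :
    (a ≫ r ≫ (b ⊗ₘ 𝟙 (𝟙_ D))) ≫ (ρ_ y).hom = a ≫ (r ≫ (ρ_ x).hom) ≫ b := by
  simp

theorem listAppend_nil_right (X : List C) :
    (listAppend c X []).hom ≫ (ρ_ (monObj c X)).hom =
      eqToHom (congrArg (monObj c) (List.append_nil X)) := by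
  refine (listAppend_nil_right_step (listIso c (X ++ [])).hom (rightAppend c X []).hom
    (listIso c X).inv).trans ?_
  refine (congrArg (fun k => (listIso c (X ++ [])).hom ≫ k ≫ (listIso c X).inv)
    (rightAppend_nil c X)).trans ?_
  rw [← assoc, listIso_eqToHom c (List.append_nil X), assoc, Iso.hom_inv_id, comp_id]

theorem listAppend_assoc (X Y Z : List C) :
    (listAppend c (X ++ Y) Z).hom ≫ (listAppend c X Y).hom ▷ monObj c Z ≫
      (α_ (monObj c X) (monObj c Y) (monObj c Z)).hom =
    eqToHom (congrArg (monObj c) (List.append_assoc X Y Z)) ≫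
      (listAppend c X (Y ++ Z)).hom ≫ monObj c X ◁ (listAppend c Y Z).hom := by
  have h := rightAppend_assoc c X Y Z
  have h₁ : (listAppend c (X ++ Y) Z).hom ≫ (listAppend c X Y).hom ▷ monObj c Z ≫
      (α_ (monObj c X) (monObj c Y) (monObj c Z)).hom =
      (listIso c ((X ++ Y) ++ Z)).hom ≫ ((rightAppend c (X ++ Y) Z).hom ≫
        (rightAppend c X Y).hom ▷ monRight c Z ≫
          (α_ (monRight c X) (monRight c Y) (monRight c Z)).hom) ≫
        ((listIso c X).inv ⊗ₘ ((listIso c Y).inv ⊗ₘ (listIso c Z).inv)) := by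
    simp only [listAppend, Iso.trans_hom, tensorIso_hom, Iso.symm_hom, assoc,
      ← associator_naturality]
    simp only [← tensorHom_id, tensorHom_comp_tensorHom_assoc]
    simp
  have h₂ : eqToHom (congrArg (monObj c) (List.append_assoc X Y Z)) ≫
      (listAppend c X (Y ++ Z)).hom ≫ monObj c X ◁ (listAppend c Y Z).hom =
      eqToHom (congrArg (monObj c) (List.append_assoc X Y Z)) ≫
      (listIso c (X ++ (Y ++ Z))).hom ≫ ((rightAppend c X (Y ++ Z)).hom ≫
        monRight c X ◁ (rightAppend c Y Z).hom) ≫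
        ((listIso c X).inv ⊗ₘ ((listIso c Y).inv ⊗ₘ (listIso c Z).inv)) := by
    simp only [listAppend, Iso.trans_hom, tensorIso_hom, Iso.symm_hom, assoc]
    simp only [← id_tensorHom, tensorHom_comp_tensorHom]
    simp
  rw [h₁, h₂, h, ← assoc (eqToHom _) (listIso c _).hom,
    ← listIso_eqToHom c (List.append_assoc X Y Z)]
  simp only [assoc]

theorem listAppend_hom (X Y Z : List C) : (listAppend c (X ++ Y) Z).hom =
    eqToHom (congrArg (monObj c) (List.append_assoc X Y Z)) ≫ (listAppend c X (Y ++ Z)).hom ≫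
      monObj c X ◁ (listAppend c Y Z).hom ≫
      (α_ (monObj c X) (monObj c Y) (monObj c Z)).inv ≫
      (listAppend c X Y).inv ▷ monObj c Z := by
  have h := listAppend_assoc c X Y Z =≫
    ((α_ (monObj c X) (monObj c Y) (monObj c Z)).inv ≫ (listAppend c X Y).inv ▷ monObj c Z)
  simpa using h

theorem listAppend_inv (X Y Z : List C) : (listAppend c (X ++ Y) Z).inv =
    (listAppend c X Y).hom ▷ monObj c Z ≫
      (α_ (monObj c X) (monObj c Y) (monObj c Z)).hom ≫
      monObj c X ◁ (listAppend c Y Z).inv ≫ (listAppend c X (Y ++ Z)).inv ≫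
      eqToHom (congrArg (monObj c) (List.append_assoc X Y Z).symm) := by
  rw [← cancel_epi (listAppend c (X ++ Y) Z).hom, Iso.hom_inv_id, listAppend_hom]
  simp

theorem interp_nil_par_step {x y : D} (m : x ≅ 𝟙_ D ⊗ x) (n : y ≅ 𝟙_ D ⊗ y) (d : x ⟶ y)
    (hm : m.hom = (λ_ x).inv) (hn : n.hom = (λ_ y).inv) :
    m.hom ≫ (𝟙 (𝟙_ D) ⊗ₘ d) ≫ n.inv = 𝟙 x ≫ d ≫ 𝟙 y := by
  rw [← assoc, Iso.comp_inv_eq, hm, hn]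
  simp

theorem interp_par_nil_step {x y x' y' : D} (m : x' ≅ x ⊗ 𝟙_ D) (n : y' ≅ y ⊗ 𝟙_ D) (d : x ⟶ y)
    (hx : x' = x) (hy : y' = y) (hm : m.hom ≫ (ρ_ x).hom = eqToHom hx)
    (hn : n.hom ≫ (ρ_ y).hom = eqToHom hy) :
    m.hom ≫ (d ⊗ₘ 𝟙 (𝟙_ D)) ≫ n.inv = eqToHom hx ≫ d ≫ eqToHom hy.symm := by
  subst hx hy
  rw [eqToHom_refl, Iso.comp_hom_eq_id] at hm hn
  rw [← assoc, Iso.comp_inv_eq, hm, hn]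
  simp

theorem interp_par_assoc_step {x x' x'' y y' y'' p p' q q' : D} (mx : p ≅ x ⊗ x')
    (my : q ≅ y ⊗ y') (mx' : p' ≅ x' ⊗ x'') (my' : q' ≅ y' ⊗ y'') (d : x ⟶ y) (d' : x' ⟶ y')
    (d'' : x'' ⟶ y'') :
    x ◁ mx'.hom ≫ (α_ x x' x'').inv ≫ mx.inv ▷ x'' ≫
      ((mx.hom ≫ (d ⊗ₘ d') ≫ my.inv) ⊗ₘ d'') ≫ my.hom ▷ y'' ≫ (α_ y y' y'').hom ≫ y ◁ my'.inv =
    d ⊗ₘ (mx'.hom ≫ (d' ⊗ₘ d'') ≫ my'.inv) := by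
  have h₁ : ((mx.hom ≫ (d ⊗ₘ d') ≫ my.inv) ⊗ₘ d'') =
      mx.hom ▷ x'' ≫ ((d ⊗ₘ d') ⊗ₘ d'') ≫ my.inv ▷ y'' := by
    simp only [← tensorHom_id, tensorHom_comp_tensorHom, id_comp, comp_id]
  have h₂ : (d ⊗ₘ (mx'.hom ≫ (d' ⊗ₘ d'') ≫ my'.inv)) =
      x ◁ mx'.hom ≫ (d ⊗ₘ (d' ⊗ₘ d'')) ≫ y ◁ my'.inv := by
    simp only [← id_tensorHom, tensorHom_comp_tensorHom, id_comp, comp_id]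
  rw [h₁, h₂]
  simp only [assoc, inv_hom_whiskerRight_assoc, associator_naturality_assoc,
    Iso.inv_hom_id_assoc]

variable {G : List C → List C → Type u}
variable (γ : ∀ {X Y : List C}, G X Y → (monObj c X ⟶ monObj c Y))

/-- The interpretation of a string diagram: sequential composition is composition, and parallel
composition is the monoidal product, up to the structural isomorphisms `m`. -/
def Diag.interp : {X Y : List C} → Diag G X Y → (monObj c X ⟶ monObj c Y)
  | _, _, .gen g => γ g
  | _, _, .id X => 𝟙 (monObj c X)
  | _, _, .swap X Y =>
      (listAppend c X Y).hom ≫ (β_ (monObj c X) (monObj c Y)).hom ≫ (listAppend c Y X).inv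
  | _, _, .comp d e => d.interp ≫ e.interp
  | _, _, .par (X := X) (Y := Y) (X' := X') (Y' := Y') d e =>
      (listAppend c X X').hom ≫ (d.interp ⊗ₘ e.interp) ≫ (listAppend c Y Y').inv

theorem Diag.interp_cast {X Y X' Y' : List C} (hX : X = X') (hY : Y = Y') (d : Diag G X Y) :
    (d.cast hX hY).interp c γ = eqToHom (congrArg (monObj c) hX.symm) ≫ d.interp c γ ≫
      eqToHom (congrArg (monObj c) hY) := by
  subst hX hY
  simp [Diag.cast]

/-- The interpretation respects the equations of a PROP. -/
theorem DiagRel.interp_eq {X Y : List C} {d e : Diag G X Y} (h : DiagRel G d e) :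
    d.interp c γ = e.interp c γ := by
  induction h with
  | refl d => rfl
  | symm _ ih => exact ih.symm
  | trans _ _ ih₁ ih₂ => exact ih₁.trans ih₂
  | comp_congr _ _ ih₁ ih₂ => simp only [Diag.interp, ih₁, ih₂]
  | par_congr _ _ ih₁ ih₂ => simp only [Diag.interp, ih₁, ih₂]
  | id_comp d => simp [Diag.interp]
  | comp_id d => simp [Diag.interp]
  | assoc d e f => simp [Diag.interp]
  | par_id X Y => simp [Diag.interp]
  | interchange d e d' e' => simp [Diag.interp]
  | @nil_par X Y d =>
    exact (interp_nil_par_step (listAppend c [] X) (listAppend c [] Y) (d.interp c γ)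
      (listAppend_nil_left c X) (listAppend_nil_left c Y)).trans
        (Diag.interp_cast c γ (List.nil_append X).symm (List.nil_append Y).symm d).symm
  | @par_nil X Y d =>
    exact (interp_par_nil_step (listAppend c X []) (listAppend c Y []) (d.interp c γ)
      (congrArg (monObj c) (List.append_nil X)) (congrArg (monObj c) (List.append_nil Y))
      (listAppend_nil_right c X) (listAppend_nil_right c Y)).trans
        (Diag.interp_cast c γ _ _ d).symm
  | @par_assoc X Y X' Y' X'' Y'' d d' d'' =>
    simp only [Diag.interp_cast, Diag.interp]
    rw [listAppend_hom, listAppend_inv, ← interp_par_assoc_step (listAppend c X X')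
      (listAppend c Y Y') (listAppend c X' X'') (listAppend c Y' Y'')]
    simp only [Category.assoc]
  | swap_swap X Y => simp [Diag.interp]
  | swap_natural d e => simp [Diag.interp]
  | hexagon X Y Z =>
    simp only [Diag.interp_cast, Diag.interp]
    rw [listAppend_hom, listAppend_inv, listAppend_inv]
    simp
    rw [← BraidedCategory.braiding_naturality_right_assoc]
    congr 1
    rw [← cancel_epi (α_ (monObj c X) (monObj c Y) (monObj c Z)).hom,
      BraidedCategory.hexagon_forward_assoc, Iso.hom_inv_id_assoc]

theorem listAppend_singleton_step (a b : D) :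
    ((ρ_ (a ⊗ b)).inv ≫ (α_ a b (𝟙_ D)).hom) ≫ (a ◁ (λ_ (b ⊗ 𝟙_ D)).inv ≫
      (α_ a (𝟙_ D) (b ⊗ 𝟙_ D)).inv) ≫ ((ρ_ a).hom ⊗ₘ (ρ_ b).hom) = 𝟙 (a ⊗ b) := by
  rw [MonoidalCategory.tensorHom_def]
  monoidal

theorem listAppend_singleton (A B : C) : (listAppend c [A] [B]).hom = 𝟙 (c A ⊗ c B) := by
  exact listAppend_singleton_step (c A) (c B)

theorem interp_swap_singleton (A B : C) :
    (Diag.swap [A] [B] : Diag G _ _).interp c γ = (β_ (c A) (c B)).hom := by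
  have h : ∀ {x y : D} (m : x ≅ x) (n : y ≅ y) (f : x ⟶ y), m.hom = 𝟙 x → n.hom = 𝟙 y →
      m.hom ≫ f ≫ n.inv = f := by
    intro x y m n f hm hn
    rw [← Category.assoc, Iso.comp_inv_eq, hm, hn]
    simp
  exact h (listAppend c [A] [B]) (listAppend c [B] [A]) _ (listAppend_singleton c A B)
    (listAppend_singleton c B A)

end Interpretation

/-! ### The Tensor-Plus calculus -/

/-- The generators of the functional Tensor-Plus calculus, other than identities and swaps. -/
inductive FGen (R : Type u) : List Color → List Color → Type u
  | tensor (A B : Color) : FGen R [A, B] [.tensor A B]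
  | tensorInv (A B : Color) : FGen R [.tensor A B] [A, B]
  | plus (A B : Color) : FGen R [A, B] [.plus A B]
  | plusInv (A B : Color) : FGen R [.plus A B] [A, B]
  | contraction (A : Color) : FGen R [A, A] [A]
  | contractionInv (A : Color) : FGen R [A] [A, A]
  | null (A : Color) : FGen R [] [A]
  | nullInv (A : Color) : FGen R [A] []
  | adapter (A A' : Color) (h : ColorEquiv A A') : FGen R [A] [A']
  | scalar (A : Color) (s : R) : FGen R [A] [A]

/-- The generators of the full Tensor-Plus calculus, other than identities and swaps. -/
inductive Gen (R : Type u) : List Color → List Color → Type u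
  | functional {X Y : List Color} (g : FGen R X Y) : Gen R X Y
  | unit : Gen R [] [.one]
  | unitInv : Gen R [.one] []

/-- The diagrams `X ⟶ Y` of the functional Tensor-Plus calculus, modulo the equations of a
PROP. -/
abbrev FCat (R : Type u) (X Y : List Color) : Type u := PropHom (FGen R) X Y

/-- The diagrams `X ⟶ Y` of the Tensor-Plus calculus, modulo the equations of a PROP. -/
abbrev TCat (R : Type u) (X Y : List Color) : Type u := PropHom (Gen R) X Y

section Semantics

variable (H : Type v) [Category.{w} H] [MonoidalCategory H] [SymmetricCategory H]
  [Semiadditive H] [Distributive H]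

/-- The object `⟦X⟧` of `H`, with `⟦[]⟧ = 0` and
`⟦[A₁, …, Aₙ]⟧ = (⋯(⟦A₁⟧ | ⟦A₂⟧) | ⋯) | ⟦Aₙ⟧`. -/
def semObj (X : List Color) : H := listObj parObj (zobj H) (semColor H) X

variable {H}
variable {R : Type u} [CommSemiring R] (scal : R ≃+* End (𝟙_ H))

/-- The semantics of the generators of the functional calculus. -/
def semFGen : {X Y : List Color} → FGen R X Y → (semObj H X ⟶ semObj H Y)
  | _, _, .tensor A B => (fst : parObj (semColor H A) (semColor H B) ⟶ _)
  | _, _, .tensorInv A B => (inl : _ ⟶ parObj (semColor H A) (semColor H B))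
  | _, _, .plus A B => (snd : parObj (semColor H A) (semColor H B) ⟶ _)
  | _, _, .plusInv A B => (inr : _ ⟶ parObj (semColor H A) (semColor H B))
  | _, _, .contraction A =>
      (snd ≫ codiag (semColor H A) : parObj (semColor H A) (semColor H A) ⟶ semColor H A)
  | _, _, .contractionInv A =>
      (diag (semColor H A) ≫ inr : semColor H A ⟶ parObj (semColor H A) (semColor H A))
  | _, _, .null A => (0 : zobj H ⟶ semColor H A)
  | _, _, .nullInv A => (0 : semColor H A ⟶ zobj H)
  | _, _, .adapter A A' h => ((adapterIso H h).hom : semColor H A ⟶ semColor H A')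
  | _, _, .scalar A s => (scalAct (scal s) (𝟙 (semColor H A)) : semColor H A ⟶ semColor H A)

/-- The semantics of the functional calculus, on terms. -/
def semFTerm {X Y : List Color} (d : Diag (FGen R) X Y) : semObj H X ⟶ semObj H Y :=
  Diag.interp (D := ParCat H) (semColor H) (semFGen scal) d

/-- The semantics `⟦d⟧` of a diagram of the functional calculus. -/
def semF {X Y : List Color} (d : FCat R X Y) : semObj H X ⟶ semObj H Y :=
  Quotient.lift (semFTerm scal) (fun _ _ h => DiagRel.interp_eq (D := ParCat H) _ _ h) d

/-- The semantics of the Unit, `Δ ∘ m : 0 ⊕ 1 ⟶ 1 ⊕ 1`. -/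
def semUnit : PlusOneHom (zobj H) (𝟙_ H) where
  val := (zeroSum (𝟙_ H)).hom ≫ diag (𝟙_ H)
  exists_eq_add := (exists_eq_add_iff _).2 ⟨0, by simp [diag]⟩

/-- The semantics of the mirrored Unit, `m ∘ ∇ : 1 ⊕ 1 ⟶ 0 ⊕ 1`. -/
def semUnitInv : PlusOneHom (𝟙_ H) (zobj H) where
  val := codiag (𝟙_ H) ≫ (zeroSum (𝟙_ H)).inv
  exists_eq_add := (exists_eq_add_iff _).2 ⟨0, by simp [codiag]⟩

/-- The semantics of the generators of the full calculus: `⟦g⟧ ⊕ id` for the functional ones. -/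
def semGen : {X Y : List Color} → Gen R X Y → PlusOneHom (semObj H X) (semObj H Y)
  | _, _, .functional g => PlusOneHom.functional (semFGen scal g)
  | _, _, .unit => (semUnit : PlusOneHom (zobj H) (𝟙_ H))
  | _, _, .unitInv => (semUnitInv : PlusOneHom (𝟙_ H) (zobj H))

/-- The semantics of the full calculus, on terms. -/
def semTerm {X Y : List Color} (d : Diag (Gen R) X Y) : PlusOneHom (semObj H X) (semObj H Y) :=
  Diag.interp (D := PlusOne H) (semColor H) (semGen scal) d

/-- The semantics `⟦d⟧^{⊕1}` of a diagram of the full calculus. -/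
def sem {X Y : List Color} (d : TCat R X Y) : PlusOneHom (semObj H X) (semObj H Y) :=
  Quotient.lift (semTerm scal) (fun _ _ h => DiagRel.interp_eq (D := PlusOne H) _ _ h) d

/-! The clauses of the two semantics. -/

theorem semFTerm_id (X : List Color) :
    semFTerm scal (.id X : Diag (FGen R) X X) = 𝟙 (semObj H X) := rfl

theorem semFTerm_comp {X Y Z : List Color} (d : Diag (FGen R) X Y) (e : Diag (FGen R) Y Z) :
    semFTerm scal (.comp d e) = semFTerm scal d ≫ semFTerm scal e := rfl

/-- The isomorphism `m : ⟦X ++ Y⟧ ≅ ⟦X⟧ | ⟦Y⟧` composed of associators and unitors of `|`. -/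
def semAppend (X Y : List Color) : semObj H (X ++ Y) ≅ parObj (semObj H X) (semObj H Y) :=
  (listAppend (D := ParCat H) (semColor H) X Y : _ ≅ _)

theorem semFTerm_par {X Y X' Y' : List Color} (d : Diag (FGen R) X Y)
    (e : Diag (FGen R) X' Y') : semFTerm scal (.par d e) =
      (semAppend X X').hom ≫ parMap (semFTerm scal d) (semFTerm scal e) ≫
        (semAppend Y Y').inv := rfl

theorem semFTerm_swap (A B : Color) :
    semFTerm scal (.swap [A] [B] : Diag (FGen R) _ _) =
      (parSwap (semColor H A) (semColor H B)).hom :=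
  interp_swap_singleton (D := ParCat H) (semColor H) (semFGen scal) A B

theorem semF_mk {X Y : List Color} (d : Diag (FGen R) X Y) :
    semF scal (PropHom.mk d) = semFTerm scal d := rfl

theorem sem_mk {X Y : List Color} (d : Diag (Gen R) X Y) :
    sem scal (PropHom.mk d) = semTerm scal d := rfl

theorem semTerm_comp {X Y Z : List Color} (d : Diag (Gen R) X Y) (e : Diag (Gen R) Y Z) :
    (semTerm scal (.comp d e)).val = (semTerm scal d).val ≫ (semTerm scal e).val := rfl

theorem plusOne_foldIso (a : H) (X : List Color) :
    foldIso (D := PlusOne H) (semColor H) a X =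
      (functionalFunctor H).mapIso (foldIso (D := ParCat H) (semColor H) a X) := by
  induction X generalizing a with
  | nil => rfl
  | cons A X ih =>
    refine (congrArg (· ≪≫ _) (ih _)).trans ?_
    exact ((functionalFunctor H).mapIso_trans _ _).symm

theorem plusOne_listIso (X : List Color) :
    listIso (D := PlusOne H) (semColor H) X =
      (functionalFunctor H).mapIso (listIso (D := ParCat H) (semColor H) X) := by
  cases X with
  | nil => exact ((functionalFunctor H).mapIso_refl _).symm
  | cons A X => exact plusOne_foldIso _ X

theorem functional_tensor {X X' Y Y' : H} (f : X ⟶ X') (g : Y ⟶ Y') :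
    PlusOneHom.tensor (PlusOneHom.functional f) (PlusOneHom.functional g) =
      PlusOneHom.functional (parMap f g) :=
  PlusOneHom.ext (expand_par' f g).symm

theorem functional_comp {X Y Z : H} (f : X ⟶ Y) (g : Y ⟶ Z) :
    PlusOneHom.comp (PlusOneHom.functional f) (PlusOneHom.functional g) =
      PlusOneHom.functional (f ≫ g) :=
  ((functionalFunctor H).map_comp f g).symm

theorem functional_whiskerLeftIso (A : H) {X Y : ParCat H} (e : X ≅ Y) :
    (whiskerLeftIso (C := PlusOne H) A ((functionalFunctor H).mapIso e)) =
      (functionalFunctor H).mapIso (whiskerLeftIso (C := ParCat H) A e) := by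
  refine Iso.ext ?_
  refine Eq.trans ?_ (functional_tensor (𝟙 A) (show (X : H) ⟶ Y from e.hom))
  exact congrArg (fun k => PlusOneHom.tensor k _) ((functionalFunctor H).map_id A).symm

theorem functional_tensorIso {X Y X' Y' : ParCat H} (e : X ≅ Y) (e' : X' ≅ Y') :
    (tensorIso (C := PlusOne H) ((functionalFunctor H).mapIso e)
      ((functionalFunctor H).mapIso e')) =
      (functionalFunctor H).mapIso (tensorIso (C := ParCat H) e e') :=
  Iso.ext (functional_tensor (H := H) e.hom e'.hom)

theorem plusOne_rightAppend (X Y : List Color) :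
    rightAppend (D := PlusOne H) (semColor H) X Y =
      (functionalFunctor H).mapIso (rightAppend (D := ParCat H) (semColor H) X Y) := by
  induction X with
  | nil => rfl
  | cons A X ih =>
    refine (congrArg (fun k => whiskerLeftIso (C := PlusOne H) (semColor H A) k ≪≫ _) ih).trans ?_
    refine (congrArg (· ≪≫ _) (functional_whiskerLeftIso _ _)).trans ?_
    exact ((functionalFunctor H).mapIso_trans
      (whiskerLeftIso (C := ParCat H) (semColor H A) (rightAppend (D := ParCat H) (semColor H) X Y))
      ((parStruct H).associator (semColor H A) (monRight (D := ParCat H) (semColor H) X)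
        (monRight (D := ParCat H) (semColor H) Y)).symm).symm

theorem plusOne_listAppend (X Y : List Color) :
    listAppend (D := PlusOne H) (semColor H) X Y =
      (functionalFunctor H).mapIso (listAppend (D := ParCat H) (semColor H) X Y) := by
  have h₁ : listAppend (D := PlusOne H) (semColor H) X Y =
      (functionalFunctor H).mapIso (listIso (D := ParCat H) (semColor H) (X ++ Y)) ≪≫
      (functionalFunctor H).mapIso (rightAppend (D := ParCat H) (semColor H) X Y) ≪≫
      tensorIso (C := PlusOne H)
        ((functionalFunctor H).mapIso (listIso (D := ParCat H) (semColor H) X).symm)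
        ((functionalFunctor H).mapIso (listIso (D := ParCat H) (semColor H) Y).symm) := by
    unfold listAppend
    rw [plusOne_listIso, plusOne_listIso, plusOne_listIso, plusOne_rightAppend]
    rfl
  refine h₁.trans ?_
  refine (congrArg (fun k => _ ≪≫ _ ≪≫ k) (functional_tensorIso
    (listIso (D := ParCat H) (semColor H) X).symm
    (listIso (D := ParCat H) (semColor H) Y).symm)).trans ?_
  exact Iso.ext ((congrArg (fun k => _ ≫ k) ((functionalFunctor H).map_comp _ _).symm).trans
    ((functionalFunctor H).map_comp _ _).symm)

theorem semTerm_par' {X Y X' Y' : List Color} (d : Diag (Gen R) X Y) (e : Diag (Gen R) X' Y') :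
    semTerm scal (.par d e) =
      PlusOneHom.comp (PlusOneHom.functional (semAppend X X').hom)
        (PlusOneHom.comp (PlusOneHom.tensor (semTerm scal d) (semTerm scal e))
          (PlusOneHom.functional (semAppend Y Y').inv)) := by
  have h₁ := congrArg Iso.hom (plusOne_listAppend (H := H) X X')
  have h₂ := congrArg Iso.inv (plusOne_listAppend (H := H) Y Y')
  exact congrArg₂ (fun p q => PlusOneHom.comp p
    (PlusOneHom.comp (PlusOneHom.tensor (semTerm scal d) (semTerm scal e)) q)) h₁ h₂

theorem semTerm_swap' (X Y : List Color) :
    semTerm scal (.swap X Y : Diag (Gen R) _ _) =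
      PlusOneHom.comp (PlusOneHom.functional (semAppend X Y).hom)
        (PlusOneHom.comp (PlusOneHom.functional (parSwap (semObj H X) (semObj H Y)).hom)
          (PlusOneHom.functional (semAppend Y X).inv)) := by
  have h₁ := congrArg Iso.hom (plusOne_listAppend (H := H) X Y)
  have h₂ := congrArg Iso.inv (plusOne_listAppend (H := H) Y X)
  exact congrArg₂ (fun p q => PlusOneHom.comp p (PlusOneHom.comp
    (PlusOneHom.functional (parSwap (semObj H X) (semObj H Y)).hom) q)) h₁ h₂

/-- The interpretation of parallel composition in `H^{⊕1}`. -/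
theorem semTerm_par {X Y X' Y' : List Color} (d : Diag (Gen R) X Y) (e : Diag (Gen R) X' Y') :
    (semTerm scal (.par d e)).val =
      sumMap (semAppend X X').hom (𝟙 (𝟙_ H)) ≫ (expand _ _).inv ≫
        ((semTerm scal d).val ⊗ₘ (semTerm scal e).val) ≫ (expand _ _).hom ≫
          sumMap (semAppend Y Y').inv (𝟙 (𝟙_ H)) := by
  rw [semTerm_par']
  simp [PlusOneHom.comp, PlusOneHom.tensor, PlusOneHom.functional]

/-- A diagram of the functional calculus, as a diagram of the full calculus. -/
def Diag.toFull : {X Y : List Color} → Diag (FGen R) X Y → Diag (Gen R) X Y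
  | _, _, .gen g => .gen (.functional g)
  | _, _, .id X => .id X
  | _, _, .swap X Y => .swap X Y
  | _, _, .comp d e => .comp d.toFull e.toFull
  | _, _, .par d e => .par d.toFull e.toFull

/-- The semantics of a functional diagram in the full calculus is `⟦d⟧ ⊕ id`. -/
theorem semTerm_toFull {X Y : List Color} (d : Diag (FGen R) X Y) :
    semTerm scal d.toFull = PlusOneHom.functional (semFTerm scal d) := by
  induction d with
  | gen g => rfl
  | id X => exact ((functionalFunctor H).map_id (semObj H X)).symm
  | swap X Y =>
    refine (semTerm_swap' scal X Y).trans ?_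
    rw [functional_comp, functional_comp]
    rfl
  | comp d e ihd ihe =>
    refine (congrArg₂ PlusOneHom.comp ihd ihe).trans ?_
    exact functional_comp _ _
  | par d e ihd ihe =>
    refine (semTerm_par' scal d.toFull e.toFull).trans ?_
    rw [ihd, ihe, functional_tensor, functional_comp, functional_comp]
    rfl

end Semantics

end

end TensorPlus

namespace TensorPlus

noncomputable section

open CategoryTheory.Category CategoryTheory.Limits CategoryTheory.MonoidalCategory

/-! ### Concatenation isomorphisms on lists of at most three colors -/

section Structural

variable {H : Type v} [Category.{w} H] [MonoidalCategory H] [SymmetricCategory H]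
  [Semiadditive H] [Distributive H]

/-! The object of a color behaves like a finite free module over `R`. By induction on the color, its
identity is a finite sum of composites `q ≫ p` through the unit object `1` (`id_mem_oneFactors`):
the empty sum for `0`, a single term for `1`, the decomposition of the identity of a biproduct for
`⊕`, and for `⊗` the products of terms, using that `⊗` is bilinear on morphisms and that `1 ⊗ 1 ≅
1`. The maps `q` and `p` are themselves semantics of diagrams, since injections, projections, sums,
tensor products and structural isomorphisms all are. Inserting the decomposition after a point `x :
1 ⟶ ⟦A⟧` writes `x` as a sum of terms `(x ≫ q) ≫ p`, where `x ≫ q` is an endomorphism of `1`, hence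
a scalar because `scal` is onto. Inserting it before `f : ⟦A⟧ ⟶ ⟦B⟧` writes `f` as a sum of terms `q
≫ (p ≫ f)`, where `p ≫ f` is a point. So every morphism between two colors comes from a functional
diagram (`colorRealizable`).

Lists reduce to colors. As `a | c = (a ⊗ c) ⊕ (a ⊕ c)`, the pair of wires `[A, C]` carries the same
object as the one color `A ⊕ (C ⊕ (A ⊗ C))`, and diagrams realize the isomorphism in both directions
(`exists_iso_color`). They do so by copying a wire, using one copy in a smaller diagram and joining
the result to the other copy with Plus (`copy_left`, `merge_left`). Conjugating by these
isomorphisms proves the functional claim (`fRealizable`).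

For the full calculus, write the given morphism between colors as `g + snd ≫ inr`. A Unit placed
beside the wire `A` duplicates the ambient summand `1`, so that one copy of `1` becomes an ordinary
wire (`unit_right`). The morphism `g : ⟦A⟧ ⊕ 1 ⟶ ⟦B⟧ ⊕ 1` then acts on ordinary wires and is
functional. The mirrored Unit adds its output to the untouched ambient copy, which contributes `snd
≫ inr` (`unitInv_right`, `comp_sumMap_comp`). Lists again follow by conjugation (`tRealizable`). -/

theorem semAppend_singleton (A B : Color) :
    (semAppend (H := H) [A] [B]).hom = 𝟙 (parObj (semColor H A) (semColor H B)) :=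
  listAppend_singleton (D := ParCat H) (semColor H) A B

theorem semAppend_singleton_inv (A B : Color) :
    (semAppend (H := H) [A] [B]).inv = 𝟙 (parObj (semColor H A) (semColor H B)) :=
  (Iso.inv_eq_inv (semAppend (H := H) [A] [B])
    (Iso.refl (parObj (semColor H A) (semColor H B)))).2 (semAppend_singleton A B)

theorem semAppend_nil_right (A : Color) :
    (semAppend (H := H) [A] []).hom = (parRightUnitor (semColor H A)).inv := by
  have h := listAppend_nil_right (D := ParCat H) (semColor H) [A]
  -- The list `[A] ++ []` reduces to `[A]`, so the transport on the right of `h` is an identity.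
  exact (Iso.comp_hom_eq_id (parRightUnitor (semColor H A))).1 h

theorem semAppend_nil_right_inv (A : Color) :
    (semAppend (H := H) [A] []).inv = (parRightUnitor (semColor H A)).hom :=
  (Iso.inv_eq_inv (semAppend (H := H) [A] []) (parRightUnitor (semColor H A)).symm).2
    (semAppend_nil_right A)

theorem semAppend_nil_left (A : Color) :
    (semAppend (H := H) [] [A]).hom = (parLeftUnitor (semColor H A)).inv :=
  listAppend_nil_left (D := ParCat H) (semColor H) [A]

theorem semAppend_nil_left_inv (A : Color) :
    (semAppend (H := H) [] [A]).inv = (parLeftUnitor (semColor H A)).hom :=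
  (Iso.inv_eq_inv (semAppend (H := H) [] [A]) (parLeftUnitor (semColor H A)).symm).2
    (semAppend_nil_left A)

/-- The shape of the associativity coherence of concatenation for three explicit wires: the
transport between the two bracketings of the list is an identity, and so are both inner
concatenation isomorphisms, which leaves only the associator. -/
theorem comp_eq_of_whisker_eq_id {D : Type v} [Category.{w} D] [MonoidalCategory D]
    {a b c p : D} {f : p ⟶ (a ⊗ b) ⊗ c} {g : p ⟶ a ⊗ b ⊗ c} {m : a ⊗ b ⟶ a ⊗ b}
    {n : b ⊗ c ⟶ b ⊗ c} (h : f ≫ m ▷ c ≫ (α_ a b c).hom = 𝟙 p ≫ g ≫ a ◁ n) (hm : m = 𝟙 _)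
    (hn : n = 𝟙 _) : f ≫ (α_ a b c).hom = g := by
  subst hm hn
  simpa using h

theorem semAppend_assoc (A B C : Color) :
    (semAppend (H := H) [A, B] [C]).hom ≫
        (parAssoc (semColor H A) (semColor H B) (semColor H C)).hom =
      (semAppend [A] [B, C]).hom :=
  comp_eq_of_whisker_eq_id (D := ParCat H)
    (listAppend_assoc (D := ParCat H) (semColor H) [A] [B] [C])
    (listAppend_singleton (D := ParCat H) (semColor H) A B)
    (listAppend_singleton (D := ParCat H) (semColor H) B C)

/-! ### Copying and merging a wire next to another wire -/

/-- The product of a column and a row: the identity of the biproduct is the sum of its two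
projection-injection composites. -/
theorem lift_desc {W X Y Z : H} (f : W ⟶ X) (g : W ⟶ Y) (h : X ⟶ Z) (k : Y ⟶ Z) :
    lift f g ≫ desc h k = f ≫ h + g ≫ k := by
  have h₁ : lift f g = f ≫ inl + g ≫ inr := lift_ext (by simp [add_comp]) (by simp [add_comp])
  simp [h₁, add_comp]

/-- Distributivity turns the diagonal of one tensor factor into the diagonal of the tensor product.
This is what makes copying one wire copy the mixed summand `X ⊗ Y` as well. -/
theorem lift_id_whiskerRight (X Y : H) :
    lift (𝟙 X) (𝟙 X) ▷ Y ≫ (distR X X Y).hom = lift (𝟙 (X ⊗ Y)) (𝟙 (X ⊗ Y)) := by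
  refine lift_ext ?_ ?_ <;> simp [distR, ← comp_whiskerRight]

theorem desc_id_whiskerRight (X Y : H) :
    (distR X X Y).inv ≫ desc (𝟙 X) (𝟙 X) ▷ Y = desc (𝟙 (X ⊗ Y)) (𝟙 (X ⊗ Y)) := by
  refine desc_ext ?_ ?_ <;> simp [distR, ← comp_whiskerRight]

/-- Copying the left factor of `X | Y`. -/
theorem copy_left {X Y E P : H} (e : parObj X Y ⟶ E) {i : parObj X Y ⟶ parObj X Y}
    {j : parObj X E ⟶ parObj X E} (m : P ≅ parObj (parObj X X) Y) (n : P ≅ parObj X (parObj X Y))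
    (hi : i = 𝟙 _) (hj : j = 𝟙 _) (h : m.hom ≫ (parAssoc X X Y).hom = n.hom) :
    ((i ≫ parMap (diag X ≫ inr) (𝟙 Y) ≫ m.inv) ≫ n.hom ≫ parMap (𝟙 X) e ≫ j) ≫ snd =
      lift (snd ≫ fst) e := by
  -- The case where `e` is the identity; the general case follows because `𝟙 | e` acts on the `⊕`
  -- part as `𝟙 ⊕ e`.
  have h₁ : parMap (diag X ≫ inr) (𝟙 Y) ≫ (parAssoc X X Y).hom ≫ snd =
      lift (snd ≫ fst) (𝟙 _) := by
    -- The summands `X ⊗ Y`, `X` and `Y` in turn. On `X ⊗ Y` one copy lands in the tensor part of `X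
    -- | (X | Y)`, which `snd` discards, and the other survives inside the inner `X | Y`.
    refine desc_ext (lift_ext ?_ ?_) (desc_ext (lift_ext ?_ ?_) (lift_ext ?_ ?_)) <;>
      simp [parAssoc, parMap, diag]
    · simp [reassoc_of% lift_id_whiskerRight, desc_comp, lift_desc]
    · simp [reassoc_of% lift_id_whiskerRight, desc_comp, lift_desc]
    · simp [desc_comp, lift_desc]
    · simp [desc_comp, lift_desc]
  subst hi hj
  rw [← h]
  have h₂ : parMap (𝟙 X) e ≫ snd = snd ≫ sumMap (𝟙 X) e := by simp [parMap]
  simp only [assoc, id_comp, Iso.inv_hom_id_assoc, h₂]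
  have h₃ := h₁ =≫ sumMap (𝟙 X) e
  simp only [assoc] at h₃
  rw [h₃]
  exact lift_ext (by simp) (by simp)

/-- Merging with the left factor of `X | Y`. -/
theorem merge_left {X Y E P : H} (e : E ⟶ parObj X Y) {i : parObj X Y ⟶ parObj X Y}
    {j : parObj X E ⟶ parObj X E} (m : P ≅ parObj (parObj X X) Y) (n : P ≅ parObj X (parObj X Y))
    (hi : i = 𝟙 _) (hj : j = 𝟙 _) (h : m.hom ≫ (parAssoc X X Y).hom = n.hom) :
    inr ≫ (j ≫ parMap (𝟙 X) e ≫ n.inv) ≫ m.hom ≫ parMap (snd ≫ codiag X) (𝟙 Y) ≫ i =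
      desc (inl ≫ inr) e := by
  have h₁ : inr ≫ (parAssoc X X Y).inv ≫ parMap (snd ≫ codiag X) (𝟙 Y) =
      desc (inl ≫ inr) (𝟙 _) := by
    refine desc_ext ?_ (desc_ext ?_ (desc_ext ?_ ?_)) <;>
      simp [parAssoc, parMap, codiag]
    -- On the summand `X ⊗ Y`, reassociation enters through the `⊕` part of `X | X`, where the
    -- whiskered projection undoes the distributor.
    have h₄ : inr ≫ (distR (X ⊗ X) (X ⊞ₛ X) Y).inv ≫ snd ▷ Y = 𝟙 _ := by
      simp [distR, desc_comp, ← comp_whiskerRight]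
    rw [reassoc_of% h₄, reassoc_of% desc_id_whiskerRight, inr_desc_assoc, id_comp]
  subst hi hj
  have h' : n.inv ≫ m.hom = (parAssoc X X Y).inv := by
    rw [Iso.inv_comp_eq, ← h, assoc, Iso.hom_inv_id, comp_id]
  have h₂ : inr ≫ parMap (𝟙 X) e = sumMap (𝟙 X) e ≫ inr := by simp [parMap]
  simp only [assoc, id_comp, comp_id]
  rw [← assoc n.inv, h', ← assoc inr, h₂, assoc, h₁]
  exact desc_ext (by simp) (by simp)

/-! ### Additivity of the tensor product, scalars, and zero morphisms beside a wire -/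

theorem comp_eq_of_eq_id {X Y : H} {i : X ⟶ X} {f : X ⟶ Y} {j : Y ⟶ Y} (hi : i = 𝟙 X)
    (hj : j = 𝟙 Y) : i ≫ f ≫ j = f := by
  rw [hi, hj, id_comp, comp_id]

/-- A sum is a pairing followed by the codiagonal, and the distributor carries both to the
corresponding maps of the tensor product. -/
theorem whiskerLeft_add' (X : H) {Y Z : H} (f g : Y ⟶ Z) : X ◁ (f + g) = X ◁ f + X ◁ g := by
  have h₁ : X ◁ lift f g ≫ (distL X Z Z).hom = lift (X ◁ f) (X ◁ g) := by
    refine lift_ext ?_ ?_ <;> simp [distL, ← whiskerLeft_comp]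
  have h₂ : (distL X Z Z).inv ≫ X ◁ codiag Z = codiag (X ⊗ Z) := by
    refine desc_ext ?_ ?_ <;> simp [distL, codiag, ← whiskerLeft_comp]
  have h₃ : ∀ {Y Z : H} (f g : Y ⟶ Z), f + g = lift f g ≫ codiag Z := homAdd_eq_lift
  rw [h₃, h₃, ← h₁, ← h₂, whiskerLeft_comp]
  simp

theorem add_whiskerRight' {Y Z : H} (f g : Y ⟶ Z) (X : H) : (f + g) ▷ X = f ▷ X + g ▷ X := by
  rw [← cancel_mono (β_ Z X).hom, add_comp]
  simp only [BraidedCategory.braiding_naturality_left, whiskerLeft_add', comp_add]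

theorem scalAct_id (x : End (𝟙_ H)) : scalAct x (𝟙 (𝟙_ H)) = (x : 𝟙_ H ⟶ 𝟙_ H) := by
  simp [scalAct, unitors_inv_equal, unitors_equal]

theorem parSwap_parSwap (X Y : H) : (parSwap X Y).hom ≫ (parSwap Y X).hom = 𝟙 (parObj X Y) :=
  SymmetricCategory.symmetry (C := ParCat H) X Y

theorem parSwap_snd_fst (X Y : H) : (parSwap X Y).hom ≫ snd ≫ fst = snd ≫ snd := by
  have h : (parSwap X Y).hom ≫ snd = snd ≫ (sumSwap X Y).hom := sumMap_snd _ _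
  rw [← assoc, h, assoc, sumSwap, lift_fst]

/-- Placing a Null beside a wire and joining with Plus: of the three summands of `X | Y` only `X` is
reached, because the unitor of `|` lands in the `⊕` part. The next three lemmas are the other side
and the mirror images, giving the other injection and the two projections. -/
theorem parMap_zero_right {X Y : H} {i : parObj X Y ⟶ parObj X Y} (hi : i = 𝟙 _) :
    ((parRightUnitor X).inv ≫ parMap (𝟙 X) (0 : zobj H ⟶ Y) ≫ i) ≫ snd = inl := by
  subst hi
  simp [parMap, parRightUnitor]

theorem parMap_zero_left {X Y : H} {i : parObj X Y ⟶ parObj X Y} (hi : i = 𝟙 _) :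
    ((parLeftUnitor Y).inv ≫ parMap (0 : zobj H ⟶ X) (𝟙 Y) ≫ i) ≫ snd = inr := by
  subst hi
  simp [parMap, parLeftUnitor]

theorem inr_parMap_zero_right {X Y : H} {i : parObj X Y ⟶ parObj X Y} (hi : i = 𝟙 _) :
    inr ≫ i ≫ parMap (𝟙 X) (0 : Y ⟶ zobj H) ≫ (parRightUnitor X).hom = fst := by
  subst hi
  simp [parMap, parRightUnitor]

theorem inr_parMap_zero_left {X Y : H} {i : parObj X Y ⟶ parObj X Y} (hi : i = 𝟙 _) :
    inr ≫ i ≫ parMap (0 : X ⟶ zobj H) (𝟙 Y) ≫ (parLeftUnitor Y).hom = snd := by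
  subst hi
  simp [parMap, parLeftUnitor]

/-- The tensor product of two morphisms factoring through `1` factors through `1 ⊗ 1 ≅ 1`. -/
theorem tensorHom_comp_leftUnitor {X X' Y Y' : H} (q : X ⟶ 𝟙_ H) (q' : X' ⟶ 𝟙_ H) (p : 𝟙_ H ⟶ Y)
    (p' : 𝟙_ H ⟶ Y') :
    ((q ⊗ₘ q') ≫ (λ_ (𝟙_ H)).hom) ≫ (λ_ (𝟙_ H)).inv ≫ (p ⊗ₘ p') = ((q ≫ p) ⊗ₘ (q' ≫ p')) := by
  simp

/-! ### The Unit and its mirror image beside a wire -/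

theorem diag_eq_add (X : H) : diag X = inl + inr :=
  lift_ext (by simp [diag, add_comp]) (by simp [diag, add_comp])

theorem rightUnitor_inv_expand_inv (X : H) :
    sumMap (parRightUnitor X).inv (𝟙 (𝟙_ H)) ≫ (expand X (zobj H)).inv =
      (ρ_ (X ⊞ₛ 𝟙_ H)).inv ≫ (X ⊞ₛ 𝟙_ H) ◁ (zeroSum (𝟙_ H)).inv := by
  have h₁ := expand_rightUnitor X =≫ sumMap (parRightUnitor X).inv (𝟙 (𝟙_ H))
  have h₂ : sumMap (parRightUnitor X).hom (𝟙 (𝟙_ H)) ≫ sumMap (parRightUnitor X).inv (𝟙 _) = 𝟙 _ := by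
    simp
  simp only [assoc, h₂, comp_id] at h₁
  rw [Iso.comp_inv_eq, assoc, h₁, Iso.inv_hom_id_assoc]

/-- Tensoring with the Unit on the right duplicates the ambient scalar wire. -/
theorem unit_right {X : H} {r : X ⟶ parObj X (zobj H)} {i : parObj X (𝟙_ H) ⟶ parObj X (𝟙_ H)}
    (hr : r = (parRightUnitor X).inv) (hi : i = 𝟙 _) :
    (sumMap r (𝟙 (𝟙_ H)) ≫ (expand X (zobj H)).inv ≫
      (𝟙 (X ⊞ₛ 𝟙_ H) ⊗ₘ ((zeroSum (𝟙_ H)).hom ≫ diag (𝟙_ H))) ≫ (expand X (𝟙_ H)).hom ≫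
        sumMap i (𝟙 (𝟙_ H))) ≫ sumMap snd (𝟙 (𝟙_ H)) = lift (𝟙 _) snd := by
  subst hr hi
  -- The diagonal is the sum of the two injections, so each summand of `X ⊕ 1` is sent to two
  -- summands of the expanded product, which `expand` identifies one by one.
  have h : (𝟙 (X ⊞ₛ 𝟙_ H) ⊗ₘ ((zeroSum (𝟙_ H)).hom ≫ diag (𝟙_ H))) =
      (X ⊞ₛ 𝟙_ H) ◁ (zeroSum (𝟙_ H)).hom ≫ ((X ⊞ₛ 𝟙_ H) ◁ inl + (X ⊞ₛ 𝟙_ H) ◁ inr) := by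
    rw [id_tensorHom, whiskerLeft_comp, diag_eq_add, whiskerLeft_add']
  simp only [assoc, sumMap_id, id_comp]
  rw [reassoc_of% rightUnitor_inv_expand_inv, h, assoc, whiskerLeft_inv_hom_assoc]
  simp only [add_comp, comp_add]
  refine desc_ext ?_ ?_
  -- The summand `X` goes to `X ⊗ 1`, killed by the final `snd`, and to `X`.
  · simp only [comp_add, rightUnitor_inv_naturality_assoc, expand_ll_assoc, expand_lr_assoc]
    refine lift_ext ?_ ?_ <;> simp [add_comp]
  -- The ambient `1` goes to the new wire `1` and to the ambient `1`; this is the duplication.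
  · simp only [comp_add, rightUnitor_inv_naturality_assoc, expand_rl_assoc, expand_rr_assoc]
    refine lift_ext (lift_ext ?_ ?_) ?_ <;> simp [add_comp, unitors_equal]

/-- Tensoring with the mirrored Unit on the right merges into the ambient scalar wire. -/
theorem unitInv_right {X : H} {r : parObj X (zobj H) ⟶ X} {i : parObj X (𝟙_ H) ⟶ parObj X (𝟙_ H)}
    (hi : i = 𝟙 _) (hr : r = (parRightUnitor X).hom) :
    sumMap inr (𝟙 (𝟙_ H)) ≫ sumMap i (𝟙 (𝟙_ H)) ≫ (expand X (𝟙_ H)).inv ≫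
      (𝟙 (X ⊞ₛ 𝟙_ H) ⊗ₘ (codiag (𝟙_ H) ≫ (zeroSum (𝟙_ H)).inv)) ≫ (expand X (zobj H)).hom ≫
        sumMap r (𝟙 (𝟙_ H)) = desc (𝟙 _) inr := by
  subst hr hi
  -- The inverse of `expand` is known on tensors of injections. Only three of the four are needed,
  -- because the leading `inr` leaves out the summand `X ⊗ 1`.
  have hl := tens_lr X (𝟙_ H)
  have hm := tens_rl X (𝟙_ H)
  have hr := tens_rr X (𝟙_ H)
  rw [← Iso.eq_comp_inv] at hl hm hr
  have h : (expand X (𝟙_ H)).inv ≫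
      (𝟙 (X ⊞ₛ 𝟙_ H) ⊗ₘ (codiag (𝟙_ H) ≫ (zeroSum (𝟙_ H)).inv)) ≫ (expand X (zobj H)).hom ≫
        sumMap (parRightUnitor X).hom (𝟙 (𝟙_ H)) =
      (expand X (𝟙_ H)).inv ≫ (X ⊞ₛ 𝟙_ H) ◁ codiag (𝟙_ H) ≫ (ρ_ (X ⊞ₛ 𝟙_ H)).hom := by
    rw [id_tensorHom, whiskerLeft_comp, assoc, expand_rightUnitor]
  rw [sumMap_id, id_comp, h]
  simp only [assoc, Iso.eq_inv_comp, ← Iso.inv_comp_eq] at hl hm hr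
  refine desc_ext (desc_ext ?_ ?_) ?_
  · rw [inl_sumMap_assoc, ← reassoc_of% hl]
    simp [MonoidalCategory.tensorHom_def, codiag, ← whiskerLeft_comp_assoc]
  · rw [inl_sumMap_assoc, ← reassoc_of% hm]
    simp [MonoidalCategory.tensorHom_def, codiag, ← whiskerLeft_comp_assoc,
      unitors_inv_equal]
  · rw [inr_sumMap_assoc, id_comp, ← reassoc_of% hr]
    simp [MonoidalCategory.tensorHom_def, codiag, ← whiskerLeft_comp_assoc,
      unitors_inv_equal]

/-- With the ambient `1` duplicated by `u` and merged by `v`, one copy runs through `g` and the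
other passes by untouched. As a product of a column, a diagonal matrix and a row this is `g` plus
the bypass, the general form of a morphism of `H^{⊕1}`. -/
theorem comp_sumMap_comp {X Y P Q : H} {u : X ⊞ₛ 𝟙_ H ⟶ P ⊞ₛ 𝟙_ H} {v : Q ⊞ₛ 𝟙_ H ⟶ Y ⊞ₛ 𝟙_ H}
    {s : P ⟶ X ⊞ₛ 𝟙_ H} {t : Y ⊞ₛ 𝟙_ H ⟶ Q} (g : X ⊞ₛ 𝟙_ H ⟶ Y ⊞ₛ 𝟙_ H)
    (hu : u ≫ sumMap s (𝟙 (𝟙_ H)) = lift (𝟙 _) snd)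
    (hv : sumMap t (𝟙 (𝟙_ H)) ≫ v = desc (𝟙 _) inr) :
    u ≫ sumMap (s ≫ g ≫ t) (𝟙 (𝟙_ H)) ≫ v = g + snd ≫ inr := by
  have h₁ : sumMap (s ≫ g ≫ t) (𝟙 (𝟙_ H)) =
      sumMap s (𝟙 (𝟙_ H)) ≫ sumMap g (𝟙 _) ≫ sumMap t (𝟙 (𝟙_ H)) := by
    simp
  have h₂ : sumMap g (𝟙 (𝟙_ H)) ≫ desc (𝟙 _) inr = desc g inr := desc_ext (by simp) (by simp)
  rw [h₁, assoc, assoc, hv, h₂, ← assoc, hu, lift_desc, id_comp]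

end Structural

/-! ### Closure properties of realizable morphisms on lists of wires -/

section Universality

variable {H : Type v} [Category.{w} H] [MonoidalCategory H] [SymmetricCategory H]
  [Semiadditive H] [Distributive H]
variable {R : Type u} [CommSemiring R] (scal : R ≃+* End (𝟙_ H))

/-- A morphism is realizable when it is the semantics of a diagram of the functional calculus. -/
def FRealizable (X Y : List Color) (f : semObj H X ⟶ semObj H Y) : Prop :=
  ∃ d : Diag (FGen R) X Y, semFTerm scal d = f

/-- Realizable morphisms between the interpretations of two colors. -/
def ColorRealizable (A B : Color) (f : semColor H A ⟶ semColor H B) : Prop :=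
  FRealizable scal [A] [B] f

namespace FRealizable

variable {scal}

theorem id (X : List Color) : FRealizable scal X X (𝟙 (semObj H X)) := ⟨.id X, rfl⟩

theorem gen {X Y : List Color} (g : FGen R X Y) : FRealizable scal X Y (semFGen scal g) :=
  ⟨.gen g, rfl⟩

theorem comp {X Y Z : List Color} {f : semObj H X ⟶ semObj H Y} {g : semObj H Y ⟶ semObj H Z}
    (hf : FRealizable scal X Y f) (hg : FRealizable scal Y Z g) :
    FRealizable scal X Z (f ≫ g) := by
  obtain ⟨d, rfl⟩ := hf
  obtain ⟨e, rfl⟩ := hg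
  exact ⟨.comp d e, rfl⟩

theorem par {X Y X' Y' : List Color} {f : semObj H X ⟶ semObj H Y}
    {g : semObj H X' ⟶ semObj H Y'} (hf : FRealizable scal X Y f)
    (hg : FRealizable scal X' Y' g) :
    FRealizable scal (X ++ X') (Y ++ Y')
      ((semAppend X X').hom ≫ parMap f g ≫ (semAppend Y Y').inv) := by
  obtain ⟨d, rfl⟩ := hf
  obtain ⟨e, rfl⟩ := hg
  exact ⟨.par d e, rfl⟩

theorem parSwap (A B : Color) :
    FRealizable scal [A, B] [B, A] (TensorPlus.parSwap (semColor H A) (semColor H B)).hom :=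
  ⟨.swap [A] [B], semFTerm_swap scal A B⟩

/-- On pairs of single wires the concatenation isomorphisms are identities and drop out. -/
theorem parMap {A B A' B' : Color} {f : semColor H A ⟶ semColor H A'}
    {g : semColor H B ⟶ semColor H B'} (hf : ColorRealizable scal A A' f)
    (hg : ColorRealizable scal B B' g) :
    FRealizable scal [A, B] [A', B'] (TensorPlus.parMap f g) := by
  obtain ⟨d, hd⟩ := hf
  obtain ⟨e, he⟩ := hg
  have h := comp_eq_of_eq_id (f := TensorPlus.parMap f g) (semAppend_singleton A B)
    (semAppend_singleton_inv A' B')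
  refine ⟨.par d e, ?_⟩
  refine (semFTerm_par scal d e).trans ?_
  rw [hd, he]
  exact h

/-- Copy the wire `A`, feed one copy together with `B` into `e`, and join the other copy to the
result with Plus. Iterating this extracts the summands of `⟦A⟧ | ⟦B⟧` one after another. -/
theorem lift_left {A B C : Color} {e : parObj (semColor H A) (semColor H B) ⟶ semColor H C}
    (he : FRealizable scal [A, B] [C] e) :
    FRealizable scal [A, B] [.plus A C] (lift (snd ≫ fst) e) := by
  have h := copy_left e (semAppend [A, A] [B]) (semAppend [A] [A, B])
      (semAppend_singleton A B) (semAppend_singleton_inv A C) (semAppend_assoc A A B)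
  have h₁ : FRealizable scal [A, B] [A, A, B] _ :=
    par (gen (scal := scal) (.contractionInv A)) (id (scal := scal) [B])
  have h₂ : FRealizable scal [A, A, B] [A, C] _ := par (id (scal := scal) [A]) he
  have h₃ := (h₁.comp h₂).comp (gen (.plus A C))
  exact h ▸ h₃

theorem desc_left {A B C : Color} {e : semColor H C ⟶ parObj (semColor H A) (semColor H B)}
    (he : FRealizable scal [C] [A, B] e) :
    FRealizable scal [.plus A C] [A, B] (desc (inl ≫ inr) e) := by
  have h := merge_left e (semAppend [A, A] [B]) (semAppend [A] [A, B])
      (semAppend_singleton_inv A B) (semAppend_singleton A C) (semAppend_assoc A A B)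
  have h₁ : FRealizable scal [A, A, B] [A, B] _ :=
    par (gen (scal := scal) (.contraction A)) (id (scal := scal) [B])
  have h₂ : FRealizable scal [A, C] [A, A, B] _ := par (id (scal := scal) [A]) he
  have h₃ := (gen (.plusInv A C)).comp (h₂.comp h₁)
  exact h ▸ h₃

/-- The left version conjugated by the swap: it now copies the wire `B`, and swapping twice restores
`e`. -/
theorem lift_right {A B C : Color} {e : parObj (semColor H A) (semColor H B) ⟶ semColor H C}
    (he : FRealizable scal [A, B] [C] e) :
    FRealizable scal [A, B] [.plus B C] (lift (snd ≫ snd) e) := by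
  have h : (TensorPlus.parSwap (semColor H A) (semColor H B)).hom ≫
      lift (snd ≫ fst) ((TensorPlus.parSwap (semColor H B) (semColor H A)).hom ≫ e) =
        lift (snd ≫ snd) e := by
    rw [comp_lift]
    refine congrArg₂ lift ?_ ?_
    · exact parSwap_snd_fst _ _
    · rw [← assoc, parSwap_parSwap, id_comp]
  exact h ▸ (parSwap A B).comp (lift_left ((parSwap B A).comp he))

theorem desc_right {A B C : Color} {e : semColor H C ⟶ parObj (semColor H A) (semColor H B)}
    (he : FRealizable scal [C] [A, B] e) :
    FRealizable scal [.plus B C] [A, B] (desc (inr ≫ inr) e) := by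
  have h : desc (inl ≫ inr) (e ≫ (TensorPlus.parSwap (semColor H A) (semColor H B)).hom) ≫
      (TensorPlus.parSwap (semColor H B) (semColor H A)).hom = desc (inr ≫ inr) e := by
    rw [desc_comp]
    refine congrArg₂ desc ?_ ?_
    · simp [TensorPlus.parSwap]
    · rw [assoc, parSwap_parSwap, comp_id]
  exact h ▸ (desc_left (he.comp (parSwap A B))).comp (parSwap B A)

end FRealizable

/-! ### The biproduct, tensor and additive structure on single wires -/

namespace ColorRealizable

variable {scal}

theorem id (A : Color) : ColorRealizable scal A A (𝟙 (semColor H A)) := FRealizable.id [A]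

theorem comp {A B C : Color} {f : semColor H A ⟶ semColor H B} {g : semColor H B ⟶ semColor H C}
    (hf : ColorRealizable scal A B f) (hg : ColorRealizable scal B C g) :
    ColorRealizable scal A C (f ≫ g) := FRealizable.comp hf hg

theorem zero (A B : Color) : ColorRealizable scal A B (0 : semColor H A ⟶ semColor H B) := by
  have h : (0 : semColor H A ⟶ zobj H) ≫ (0 : zobj H ⟶ semColor H B) = 0 := zero_comp
  exact h ▸ (FRealizable.gen (scal := scal) (.nullInv A)).comp (FRealizable.gen (.null B))

/-- The formula `∇ ∘ (f ⊕ g) ∘ Δ` read as a diagram: the mirrored Contraction copies the input, `f`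
and `g` act in parallel, and the Contraction adds the outputs. The summand `f ⊗ g` of the parallel
composite is never reached. -/
theorem add {A B : Color} {f g : semColor H A ⟶ semColor H B}
    (hf : ColorRealizable scal A B f) (hg : ColorRealizable scal A B g) :
    ColorRealizable scal A B (f + g) := by
  have h : (diag (semColor H A) ≫ inr) ≫ parMap f g ≫ snd ≫ codiag (semColor H B) = f + g := by
    simp [parMap, add_def]
  exact h ▸ (FRealizable.gen (scal := scal) (.contractionInv A)).comp
    ((FRealizable.parMap hf hg).comp (FRealizable.gen (.contraction B)))

/-- Between a mirrored Tensor and a Tensor only the `⊗` summand of the parallel composite is seen.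
-/
theorem tensorHom {A B A' B' : Color} {f : semColor H A ⟶ semColor H A'}
    {g : semColor H B ⟶ semColor H B'} (hf : ColorRealizable scal A A' f)
    (hg : ColorRealizable scal B B' g) :
    ColorRealizable scal (.tensor A B) (.tensor A' B') (f ⊗ₘ g) := by
  have h : inl ≫ parMap f g ≫ fst = (f ⊗ₘ g) := by simp [parMap]
  exact h ▸ (FRealizable.gen (scal := scal) (.tensorInv A B)).comp
    ((FRealizable.parMap hf hg).comp (FRealizable.gen (.tensor A' B')))

theorem inl (A B : Color) :
    ColorRealizable scal A (.plus A B) (inl : semColor H A ⟶ semColor H A ⊞ₛ semColor H B) := by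
  have h : ((semAppend [A] []).hom ≫ parMap (𝟙 (semColor H A)) (0 : zobj H ⟶ semColor H B) ≫
      (semAppend [A] [B]).inv) ≫ snd = TensorPlus.inl := by
    rw [semAppend_nil_right]
    exact parMap_zero_right (semAppend_singleton_inv A B)
  exact h ▸ (FRealizable.par (FRealizable.id (scal := scal) [A])
    (FRealizable.gen (.null B))).comp (FRealizable.gen (.plus A B))

theorem inr (A B : Color) :
    ColorRealizable scal B (.plus A B) (inr : semColor H B ⟶ semColor H A ⊞ₛ semColor H B) := by
  have h : ((semAppend [] [B]).hom ≫ parMap (0 : zobj H ⟶ semColor H A) (𝟙 (semColor H B)) ≫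
      (semAppend [A] [B]).inv) ≫ snd = TensorPlus.inr := by
    rw [semAppend_nil_left]
    exact parMap_zero_left (semAppend_singleton_inv A B)
  exact h ▸ (FRealizable.par (FRealizable.gen (scal := scal) (.null A))
    (FRealizable.id [B])).comp (FRealizable.gen (.plus A B))

theorem fst (A B : Color) :
    ColorRealizable scal (.plus A B) A (fst : semColor H A ⊞ₛ semColor H B ⟶ semColor H A) := by
  have h : TensorPlus.inr ≫ (semAppend [A] [B]).hom ≫
      parMap (𝟙 (semColor H A)) (0 : semColor H B ⟶ zobj H) ≫ (semAppend [A] []).inv =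
        TensorPlus.fst := by
    rw [semAppend_nil_right_inv]
    exact inr_parMap_zero_right (semAppend_singleton A B)
  exact h ▸ (FRealizable.gen (scal := scal) (.plusInv A B)).comp
    (FRealizable.par (FRealizable.id (scal := scal) [A]) (FRealizable.gen (.nullInv B)))

theorem snd (A B : Color) :
    ColorRealizable scal (.plus A B) B (snd : semColor H A ⊞ₛ semColor H B ⟶ semColor H B) := by
  have h : TensorPlus.inr ≫ (semAppend [A] [B]).hom ≫
      parMap (0 : semColor H A ⟶ zobj H) (𝟙 (semColor H B)) ≫ (semAppend [] [B]).inv =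
        TensorPlus.snd := by
    rw [semAppend_nil_left_inv]
    exact inr_parMap_zero_left (semAppend_singleton A B)
  exact h ▸ (FRealizable.gen (scal := scal) (.plusInv A B)).comp
    (FRealizable.par (FRealizable.gen (scal := scal) (.nullInv A)) (FRealizable.id [B]))

theorem path {A B : Color} (p : ColorPath A B) : ColorRealizable scal A B (p.sem H).hom := by
  have h : (adapterIso H ⟨p⟩).hom = (p.sem H).hom := congrArg Iso.hom (adapterIso_eq H p)
  exact h ▸ FRealizable.gen (scal := scal) (.adapter A B ⟨p⟩)

/-- This is where the surjectivity of `scal` enters: every endomorphism of `1` is a Scalar on the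
wire `1`. -/
theorem endOne (x : 𝟙_ H ⟶ 𝟙_ H) : ColorRealizable scal .one .one x := by
  obtain ⟨s, hs⟩ := scal.surjective x
  have h : scalAct (scal s) (𝟙 (𝟙_ H)) = x := (scalAct_id _).trans hs
  exact h ▸ FRealizable.gen (scal := scal) (.scalar .one s)

end ColorRealizable

/-! ### Decomposition of morphisms through the unit object -/

/-- The sums of realizable morphisms that factor realizably through the monoidal unit. -/
def oneFactors (A B : Color) : AddSubmonoid (semColor H A ⟶ semColor H B) :=
  AddSubmonoid.closure {h | ∃ (q : semColor H A ⟶ 𝟙_ H) (p : 𝟙_ H ⟶ semColor H B),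
    ColorRealizable scal A .one q ∧ ColorRealizable scal .one B p ∧ q ≫ p = h}

variable {scal}

theorem oneFactors_comp {A A' B B' : Color} {u : semColor H A' ⟶ semColor H A}
    {h : semColor H A ⟶ semColor H B} {v : semColor H B ⟶ semColor H B'}
    (hu : ColorRealizable scal A' A u) (hh : h ∈ oneFactors scal A B)
    (hv : ColorRealizable scal B B' v) : u ≫ h ≫ v ∈ oneFactors scal A' B' := by
  induction hh using AddSubmonoid.closure_induction with
  | mem h hh =>
    obtain ⟨q, p, hq, hp, rfl⟩ := hh
    exact AddSubmonoid.subset_closure ⟨u ≫ q, p ≫ v, hu.comp hq, hp.comp hv, by simp⟩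
  | zero => simp
  | add a b _ _ ha hb => simpa only [add_comp, comp_add] using (oneFactors scal A' B').add_mem ha hb

/-- By bilinearity of `⊗` it suffices to treat single composites through `1`; these recombine
through `1 ⊗ 1 ≅ 1`, whose two directions are Adapters. -/
theorem oneFactors_tensorHom {A A' B B' : Color} {f : semColor H A ⟶ semColor H A'}
    {g : semColor H B ⟶ semColor H B'} (hf : f ∈ oneFactors scal A A')
    (hg : g ∈ oneFactors scal B B') :
    (f ⊗ₘ g) ∈ oneFactors scal (.tensor A B) (.tensor A' B') := by
  induction hf using AddSubmonoid.closure_induction with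
  | mem f hf =>
    obtain ⟨q, p, hq, hp, rfl⟩ := hf
    induction hg using AddSubmonoid.closure_induction with
    | mem g hg =>
      obtain ⟨q', p', hq', hp', rfl⟩ := hg
      refine AddSubmonoid.subset_closure ⟨(q ⊗ₘ q') ≫ (λ_ (𝟙_ H)).hom,
        (λ_ (𝟙_ H)).inv ≫ (p ⊗ₘ p'), ?_, ?_,
        tensorHom_comp_leftUnitor q q' p p'⟩
      · exact (hq.tensorHom hq').comp (.path (.oneTensor .one))
      · exact ColorRealizable.comp (.path (.symm (.oneTensor .one))) (hp.tensorHom hp')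
    | zero =>
      have h : ((q ≫ p) ⊗ₘ (0 : semColor H B ⟶ semColor H B')) = 0 := by
        rw [MonoidalCategory.tensorHom_def, whiskerLeft_zero', comp_zero]
      exact h ▸ AddSubmonoid.zero_mem _
    | add a b _ _ ha hb =>
      have h : ((q ≫ p) ⊗ₘ (a + b)) = ((q ≫ p) ⊗ₘ a) + ((q ≫ p) ⊗ₘ b) := by
        simp only [MonoidalCategory.tensorHom_def, whiskerLeft_add', comp_add]
      exact h ▸ AddSubmonoid.add_mem _ ha hb
  | zero =>
    have h : ((0 : semColor H A ⟶ semColor H A') ⊗ₘ g) = 0 := by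
      rw [MonoidalCategory.tensorHom_def, zero_whiskerRight', zero_comp]
    exact h ▸ AddSubmonoid.zero_mem _
  | add a b _ _ ha hb =>
    have h : ((a + b) ⊗ₘ g) = (a ⊗ₘ g) + (b ⊗ₘ g) := by
      simp only [MonoidalCategory.tensorHom_def, add_whiskerRight', add_comp]
    exact h ▸ AddSubmonoid.add_mem _ ha hb

/-- The analogue of finite freeness, proved along the color: no basis vector for `0`, one for `1`,
the union of bases for `⊕`, the product of bases for `⊗`. -/
theorem id_mem_oneFactors : (A : Color) → 𝟙 (semColor H A) ∈ oneFactors scal A A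
  | .zero => by
    have h : (0 : semColor H .zero ⟶ semColor H .zero) = 𝟙 _ := zobj_hom_ext (H := H) _ _
    exact h ▸ AddSubmonoid.zero_mem _
  | .one => AddSubmonoid.subset_closure ⟨𝟙 _, 𝟙 _, .id .one, .id .one, id_comp _⟩
  | .plus A B => by
    have h : fst ≫ 𝟙 (semColor H A) ≫ inl + snd ≫ 𝟙 (semColor H B) ≫ inr = 𝟙 _ :=
      desc_ext (by simp [comp_add]) (by simp [comp_add])
    exact h ▸ AddSubmonoid.add_mem _
      (oneFactors_comp (.fst A B) (id_mem_oneFactors A) (.inl A B))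
      (oneFactors_comp (.snd A B) (id_mem_oneFactors B) (.inr A B))
  | .tensor A B => by
    have h : (𝟙 (semColor H A) ⊗ₘ 𝟙 (semColor H B)) = 𝟙 _ := id_tensorHom_id _ _
    exact h ▸ oneFactors_tensorHom (id_mem_oneFactors A) (id_mem_oneFactors B)

/-- A point is the sum of its coordinates times basis vectors: composing `x` with a term `q ≫ p` of
the identity gives the scalar `x ≫ q` followed by the realizable `p`. -/
theorem colorRealizable_point (A : Color) (x : 𝟙_ H ⟶ semColor H A) :
    ColorRealizable scal .one A x := by
  have key : ∀ h ∈ oneFactors scal A A, ColorRealizable scal .one A (x ≫ h) := by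
    intro h hh
    induction hh using AddSubmonoid.closure_induction with
    | mem h hh =>
      obtain ⟨q, p, -, hp, rfl⟩ := hh
      exact assoc x q p ▸ (ColorRealizable.endOne (x ≫ q)).comp hp
    | zero => exact (comp_zero (f := x)).symm ▸ ColorRealizable.zero .one A
    | add a b _ _ ha hb => exact (comp_add x a b).symm ▸ ColorRealizable.add ha hb
  exact comp_id x ▸ key _ (id_mem_oneFactors A)

/-- Every morphism between interpretations of colors is realizable. -/
theorem colorRealizable {A B : Color} (f : semColor H A ⟶ semColor H B) :
    ColorRealizable scal A B f := by
  -- The decomposition is inserted on the source side: a term `q ≫ p` becomes the realizable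
  -- functional `q` followed by the point `p ≫ f`, that is, one column of the matrix of `f`.
  have key : ∀ h ∈ oneFactors scal A A, ColorRealizable scal A B (h ≫ f) := by
    intro h hh
    induction hh using AddSubmonoid.closure_induction with
    | mem h hh =>
      obtain ⟨q, p, hq, -, rfl⟩ := hh
      exact (assoc q p f).symm ▸ hq.comp (colorRealizable_point B (p ≫ f))
    | zero => exact (zero_comp (f := f)).symm ▸ ColorRealizable.zero A B
    | add a b _ _ ha hb => exact (add_comp a b f).symm ▸ ColorRealizable.add ha hb
  exact id_comp f ▸ key _ (id_mem_oneFactors A)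

/-! ### Reduction of lists to a single color, and the functional calculus -/

variable (scal)

/-- Every list of colors is isomorphic to a single color, by diagrams of the functional
calculus. -/
theorem exists_iso_color (X : List Color) : ∃ (C : Color) (e : semObj H X ≅ semColor H C),
    FRealizable scal X [C] e.hom ∧ FRealizable scal [C] X e.inv := by
  induction X with
  | nil =>
    let e : zobj H ≅ zobj H :=
      { hom := 0, inv := 0, hom_inv_id := zobj_hom_ext _ _, inv_hom_id := zobj_hom_ext _ _ }
    exact ⟨.zero, e, .gen (.null .zero), .gen (.nullInv .zero)⟩
  | cons A X ih =>
    obtain ⟨C, e, h₁, h₂⟩ := ih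
    let a := semColor H A
    let c := semColor H C
    -- The summands are ordered `a`, `c`, `a ⊗ c` so that both directions are literally nested
    -- applications of the copying and merging constructions, starting from Tensor and its mirror
    -- image.
    let u : parObj a c ≅ a ⊞ₛ (c ⊞ₛ (a ⊗ c)) :=
      { hom := lift (snd ≫ fst) (lift (snd ≫ snd) fst)
        inv := desc (inl ≫ inr) (desc (inr ≫ inr) inl)
        hom_inv_id := by
          refine desc_ext ?_ (desc_ext ?_ ?_) <;> simp [comp_add, lift_desc]
        inv_hom_id := by
          refine desc_ext ?_ (desc_ext ?_ ?_) <;>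
            refine lift_ext ?_ (lift_ext ?_ ?_) <;> simp }
    have hu : FRealizable scal [A, C] [.plus A (.plus C (.tensor A C))] u.hom :=
      .lift_left (.lift_right (.gen (.tensor A C)))
    have hu' : FRealizable scal [.plus A (.plus C (.tensor A C))] [A, C] u.inv :=
      .desc_left (.desc_right (.gen (.tensorInv A C)))
    let m : parObj a (semObj H X) ≅ parObj a c := sumIso (Iso.refl a ⊗ᵢ e) (sumIso (Iso.refl a) e)
    refine ⟨.plus A (.plus C (.tensor A C)), (semAppend [A] X ≪≫ m ≪≫ (semAppend [A] [C]).symm) ≪≫ u,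
      ?_, ?_⟩
    · exact (FRealizable.par (FRealizable.id (scal := scal) [A]) h₁).comp hu
    · have h := hu'.comp (FRealizable.par (FRealizable.id (scal := scal) [A]) h₂)
      have h₃ : u.inv ≫ (semAppend [A] [C]).hom ≫ m.inv ≫ (semAppend [A] X).inv =
        ((semAppend [A] X ≪≫ m ≪≫ (semAppend [A] [C]).symm) ≪≫ u).inv :=
        congrArg (u.inv ≫ ·) (assoc _ _ _).symm
      exact h₃ ▸ h

/-- Universality of the functional calculus. -/
theorem fRealizable {X Y : List Color} (f : semObj H X ⟶ semObj H Y) : FRealizable scal X Y f := by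
  obtain ⟨A, e, he, -⟩ := exists_iso_color scal X
  obtain ⟨B, e', -, he'⟩ := exists_iso_color scal Y
  have h : e.hom ≫ (e.inv ≫ f ≫ e'.hom) ≫ e'.inv = f := by simp
  exact h ▸ he.comp (FRealizable.comp (colorRealizable (e.inv ≫ f ≫ e'.hom)) he')

/-! ### The full calculus -/

/-- A morphism of `H^{⊕1}` is realizable when it is the semantics of a diagram. -/
def TRealizable (X Y : List Color) (f : PlusOneHom (semObj H X) (semObj H Y)) : Prop :=
  ∃ d : Diag (Gen R) X Y, semTerm scal d = f

variable {scal}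

theorem TRealizable.comp {X Y Z : List Color} {f : PlusOneHom (semObj H X) (semObj H Y)}
    {g : PlusOneHom (semObj H Y) (semObj H Z)} (hf : TRealizable scal X Y f)
    (hg : TRealizable scal Y Z g) : TRealizable scal X Z (f.comp g) := by
  obtain ⟨d, rfl⟩ := hf
  obtain ⟨e, rfl⟩ := hg
  exact ⟨.comp d e, rfl⟩

theorem TRealizable.functional {X Y : List Color} (f : semObj H X ⟶ semObj H Y) :
    TRealizable scal X Y (PlusOneHom.functional f) := by
  obtain ⟨d, rfl⟩ := fRealizable scal f
  exact ⟨d.toFull, semTerm_toFull scal d⟩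

/-- The diagram is the wire `A` beside a Unit. Its value is only needed after projecting `⟦A⟧ | 1`
to `⟦A⟧ ⊕ 1`, where it becomes the duplication of the ambient `1`. -/
theorem TRealizable.unitRight (A : Color) : ∃ f : PlusOneHom (semObj H [A]) (semObj H [A, .one]),
    TRealizable scal [A] [A, .one] f ∧
      f.val ≫ sumMap (snd : parObj (semColor H A) (𝟙_ H) ⟶ _) (𝟙 (𝟙_ H)) = lift (𝟙 _) snd := by
  refine ⟨semTerm scal (.par (.id [A]) (.gen .unit)), ⟨.par (.id [A]) (.gen .unit), rfl⟩, ?_⟩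
  rw [semTerm_par]
  exact unit_right (semAppend_nil_right A) (semAppend_singleton_inv A .one)

theorem TRealizable.unitInvRight (A : Color) :
    ∃ f : PlusOneHom (semObj H [A, .one]) (semObj H [A]),
      TRealizable scal [A, .one] [A] f ∧
        sumMap (inr : _ ⟶ parObj (semColor H A) (𝟙_ H)) (𝟙 (𝟙_ H)) ≫ f.val = desc (𝟙 _) inr := by
  refine ⟨semTerm scal (.par (.id [A]) (.gen .unitInv)), ⟨.par (.id [A]) (.gen .unitInv), rfl⟩, ?_⟩
  rw [semTerm_par]
  exact unitInv_right (semAppend_singleton A .one) (semAppend_nil_right_inv A)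

theorem tRealizable_color {A B : Color} (f : PlusOneHom (semColor H A) (semColor H B)) :
    TRealizable scal [A] [B] f := by
  obtain ⟨u, hu, hu'⟩ := TRealizable.unitRight (scal := scal) A
  obtain ⟨v, hv, hv'⟩ := TRealizable.unitInvRight (scal := scal) B
  obtain ⟨g, hg⟩ := f.exists_eq_add
  -- The morphism `g` has the ambient `1` in its source and target; here those are replaced by
  -- actual wires `1`, with the tensor parts discarded and filled with zero. Universality of the
  -- functional calculus applies to `k` even though it acts on two wires.
  let k : semObj H [A, .one] ⟶ semObj H [B, .one] :=
    (snd ≫ g ≫ inr : parObj (semColor H A) (𝟙_ H) ⟶ parObj (semColor H B) (𝟙_ H))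
  have h : u.comp ((PlusOneHom.functional k).comp v) = f :=
    PlusOneHom.ext ((comp_sumMap_comp g hu' hv').trans hg.symm)
  exact h ▸ hu.comp ((TRealizable.functional k).comp hv)

variable (scal)

/-- Universality of the full calculus. -/
theorem tRealizable {X Y : List Color} (f : PlusOneHom (semObj H X) (semObj H Y)) :
    TRealizable scal X Y f := by
  obtain ⟨A, e, -, -⟩ := exists_iso_color scal X
  obtain ⟨B, e', -, -⟩ := exists_iso_color scal Y
  let g : PlusOneHom (semColor H A) (semColor H B) :=
    (PlusOneHom.functional e.inv).comp (f.comp (PlusOneHom.functional e'.hom))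
  have h : (PlusOneHom.functional e.hom).comp (g.comp (PlusOneHom.functional e'.inv)) = f := by
    refine PlusOneHom.ext ?_
    have h₁ : sumMap e.hom (𝟙 (𝟙_ H)) ≫ sumMap e.inv (𝟙 (𝟙_ H)) = 𝟙 _ := by simp
    have h₂ : sumMap e'.hom (𝟙 (𝟙_ H)) ≫ sumMap e'.inv (𝟙 (𝟙_ H)) = 𝟙 _ := by simp
    simp [g, PlusOneHom.comp, PlusOneHom.functional, reassoc_of% h₁, h₂]
  -- The conjugating isomorphisms are morphisms of `H`, so they are covered by the functional case.
  have h₃ : TRealizable scal X [A] (PlusOneHom.functional e.hom) :=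
    TRealizable.functional (Y := [A]) e.hom
  have h₄ : TRealizable scal [B] Y (PlusOneHom.functional e'.inv) :=
    TRealizable.functional (X := [B]) e'.inv
  exact h ▸ h₃.comp (TRealizable.comp (tRealizable_color g) h₄)

end Universality

end

end TensorPlus

/-- Universality of the functional and of the full Tensor-Plus calculus. -/
theorem mainTheorem2 {R : Type u} [CommSemiring R]
    {H : Type v} [Category.{w} H] [MonoidalCategory H] [SymmetricCategory H]
    [TensorPlus.Semiadditive H] [TensorPlus.Distributive H] (scal : R ≃+* End (𝟙_ H))
    (X Y : List TensorPlus.Color) :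
    (∀ f : TensorPlus.semObj H X ⟶ TensorPlus.semObj H Y,
      ∃ d : TensorPlus.FCat R X Y, TensorPlus.semF scal d = f) ∧
    (∀ f : TensorPlus.PlusOneHom (TensorPlus.semObj H X) (TensorPlus.semObj H Y),
      ∃ d : TensorPlus.TCat R X Y, TensorPlus.sem scal d = f) := by
  refine ⟨fun f => ?_, fun f => ?_⟩
  · obtain ⟨d, hd⟩ := TensorPlus.fRealizable scal f
    exact ⟨TensorPlus.PropHom.mk d, hd⟩
  · obtain ⟨d, hd⟩ := TensorPlus.tRealizable scal f
    exact ⟨TensorPlus.PropHom.mk d, hd⟩
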